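/- **Setting.** Let $n\ge 1$, $p$ and $L\ge 2$ be integers. A random pair $(X,Y)$ has a label $Y\in\{e_1,\dots,e_L\}$ (the canonical basis of $\mathbb R^L$) with $\pi_\ell=\mathbb P\{Y=e_\ell\}>0$, and a feature $X\in\mathbb R^p$ with $X\mid Y=e_\ell\sim\mathcal N_p(\mu_\ell,\Sigma_W)$ for every $\ell$, where $\Sigma_W$ is positive definite, and $\mathbb E X=0$. Put $B=[\mathrm{Cov}(X)]^{-1}\mathrm{Cov}(X,Y)\in\mathbb R^{p\times L}$ and $r=\mathrm{rank}(B)$. Let $(X_1,Y_1),\dots,(X_n,Y_n)$ be i.i.d. copies of $(X,Y)$, and let $\mathbf X\in\mathbb R^{n\times p}$ and $\mathbf Y\in\{0,1\}^{n\times L}$ be the matrices with rows $X_i^\top$ and $Y_i^\top$. For $\lambda>0$ let $\widehat B$ be any global minimizer over $A\in\mathbb R^{p\times L}$ of $$\frac1n\|\mathbf Y-\mathbf X A\|_F^2+\lambda\,\mathrm{rank}(A).$$ **Assumptions.** For fixed constants $0<c_\pi\le C_\pi<\infty$, $0<c_\Delta\le C_\Delta<\infty$, $0<c_W\le C_W<\infty$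 and some $\Delta>0$: 1. $c_\pi/L\le\pi_\ell\le C_\pi/L$ for all $\ell$; 2. $c_\Delta\Delta\le(\mu_k-\mu_\ell)^\top\Sigma_W^{-1}(\mu_k-\mu_\ell)\le C_\Delta\Delta$ for all $k\ne\ell$; 3. the smallest eigenvalue of $\Sigma_W$ exceeds $c_W$, and $\max_{i,j}|[\Sigma_W]_{ij}|\le C_W$. **Theorem 8.** There exist constants $c,C,K_1,K_2>0$, depending only on $c_\pi,C_\pi,c_\Delta,C_\Delta,c_W,C_W$, such that in the above setting, if $$(p+L)\log n\le c\,n\qquad\text{and}\qquad \lambda\ge C\sqrt{\|\Sigma_W\|_{\rm op}(1+\Delta)}\,\sqrt{\frac{(p+L)\log n}{nL}},$$ then, with probability at least $1-2n^{-1}$, $$\max\Bigl\{n^{-1/2}\|\mathbf X(\widehat B-B)\|_F,\ \|\Sigma_W^{1/2}(\widehat B-B)\|_F\Bigr\}\le\omega_2,\qquad \sum_{j=1}^p\|(\widehat B-B)_{j\cdot}\|_2\le\omega_1,$$ where $\omega_2=K_2\sqrt{\lambda r}$ and $\omega_1=K_1\sqrt{\lambda r p}$. -/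

import Mathlib

open MeasureTheory ProbabilityTheory

namespace LDARegression

noncomputable section

/-- The Frobenius norm `‖Q‖_F`. -/
def frobNorm {m n : ℕ} (Q : Matrix (Fin m) (Fin n) ℝ) : ℝ :=
  √(∑ i, ∑ j, Q i j ^ 2)

/-- The norm `‖Q‖_{1,2}`: the sum of the Euclidean norms of the rows. -/
def rowNorm {m n : ℕ} (Q : Matrix (Fin m) (Fin n) ℝ) : ℝ :=
  ∑ i, √(∑ j, Q i j ^ 2)

/-- The operator norm `‖Q‖_op` of a square matrix acting on Euclidean space. -/
def opNorm {p : ℕ} (Q : Matrix (Fin p) (Fin p) ℝ) : ℝ :=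
  ‖Matrix.toEuclideanCLM (𝕜 := ℝ) Q‖

open scoped MatrixOrder in
/-- The positive semidefinite square root `S^{1/2}`. -/
def sqrtMat {p : ℕ} (S : Matrix (Fin p) (Fin p) ℝ) : Matrix (Fin p) (Fin p) ℝ :=
  CFC.sqrt S

/-- The space of a feature and its label; the label `ℓ` stands for the basis vector `e_ℓ`. -/
abbrev Obs (p L : ℕ) : Type := EuclideanSpace ℝ (Fin p) × Fin L

/-- The coordinate `Y_ℓ` of the one-hot encoding of the label. -/
def oneHot {L : ℕ} (y ℓ : Fin L) : ℝ := if y = ℓ then 1 else 0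

/-- `ν` is the joint law of a pair `(X, Y)` with class probabilities `prior`, with
`X | Y = e_ℓ ∼ N_p(μ_ℓ, S)` for a positive definite `S`, and with `E X = 0`. -/
structure IsLDALaw {p L : ℕ} (ν : Measure (Obs p L)) (prior : Fin L → ℝ)
    (μ : Fin L → EuclideanSpace ℝ (Fin p)) (S : Matrix (Fin p) (Fin p) ℝ) : Prop where
  isProbabilityMeasure : IsProbabilityMeasure ν
  prior_pos : ∀ ℓ, 0 < prior ℓ
  prob_label : ∀ ℓ, ν.real (Prod.snd ⁻¹' {ℓ}) = prior ℓ
  posDef : S.PosDef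
  cond_feature : ∀ ℓ, (cond ν (Prod.snd ⁻¹' {ℓ})).map Prod.fst = multivariateGaussian (μ ℓ) S
  centered : ∫ z, z.1 ∂ν = 0

/-- The unconditional covariance matrix `Σ = Cov(X)`. -/
def covX {p L : ℕ} (ν : Measure (Obs p L)) : Matrix (Fin p) (Fin p) ℝ :=
  Matrix.of fun i j => covariance (fun z : Obs p L => z.1 i) (fun z : Obs p L => z.1 j) ν

/-- The cross-covariance matrix `Cov(X, Y)`. -/
def covXY {p L : ℕ} (ν : Measure (Obs p L)) : Matrix (Fin p) (Fin L) ℝ :=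
  Matrix.of fun i ℓ =>
    covariance (fun z : Obs p L => z.1 i) (fun z : Obs p L => oneHot z.2 ℓ) ν

/-- The regression matrix `B = Cov(X)⁻¹ Cov(X, Y)`. -/
def regMatrix {p L : ℕ} (ν : Measure (Obs p L)) : Matrix (Fin p) (Fin L) ℝ :=
  (covX ν)⁻¹ * covXY ν

/-- The class probabilities are all of order `1 / L`. -/
def BalancedPriors {L : ℕ} (c C : ℝ) (prior : Fin L → ℝ) : Prop :=
  ∀ ℓ, c / L ≤ prior ℓ ∧ prior ℓ ≤ C / L

/-- The pairwise squared Mahalanobis distances of the class means are all of order `Δ`. -/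
def SeparatedMeans {p L : ℕ} (c C Δ : ℝ) (μ : Fin L → EuclideanSpace ℝ (Fin p))
    (S : Matrix (Fin p) (Fin p) ℝ) : Prop :=
  ∀ k ℓ, k ≠ ℓ →
    c * Δ ≤ (μ k - μ ℓ).ofLp ⬝ᵥ S⁻¹.mulVec (μ k - μ ℓ).ofLp ∧
      (μ k - μ ℓ).ofLp ⬝ᵥ S⁻¹.mulVec (μ k - μ ℓ).ofLp ≤ C * Δ

/-- The eigenvalues of `S` exceed `c` and its entries are at most `C` in absolute value. -/
def BoundedWithinCov {p : ℕ} (c C : ℝ) (S : Matrix (Fin p) (Fin p) ℝ) : Prop :=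
  (∃ hS : S.IsHermitian, ∀ j, c < hS.eigenvalues j) ∧ ∀ i j, |S i j| ≤ C

/-- The `n × p` feature matrix of a sample. -/
def featureMatrix {n p L : ℕ} (d : Fin n → Obs p L) : Matrix (Fin n) (Fin p) ℝ :=
  Matrix.of fun i j => (d i).1 j

/-- The `n × L` response matrix of a sample. -/
def responseMatrix {n p L : ℕ} (d : Fin n → Obs p L) : Matrix (Fin n) (Fin L) ℝ :=
  Matrix.of fun i ℓ => oneHot (d i).2 ℓ

/-- The rank-penalized least squares criterion `(1/n)‖Y - X A‖_F² + lam · rank(A)`. -/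
def rankCriterion {n p L : ℕ} (lam : ℝ) (d : Fin n → Obs p L)
    (A : Matrix (Fin p) (Fin L) ℝ) : ℝ :=
  1 / (n : ℝ) * frobNorm (responseMatrix d - featureMatrix d * A) ^ 2 + lam * (A.rank : ℝ)

/-- `A` is a reduced-rank regression estimate: a global minimizer of the criterion. -/
def IsRankEstimate {n p L : ℕ} (lam : ℝ) (d : Fin n → Obs p L)
    (A : Matrix (Fin p) (Fin L) ℝ) : Prop :=
  ∀ A' : Matrix (Fin p) (Fin L) ℝ, rankCriterion lam d A ≤ rankCriterion lam d A'

/-- The inequalities of the generic error condition, for an estimate `A` of `B`. -/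
def ErrorBounds {n p L : ℕ} (d : Fin n → Obs p L) (S : Matrix (Fin p) (Fin p) ℝ)
    (A B : Matrix (Fin p) (Fin L) ℝ) (ω₁ ω₂ : ℝ) : Prop :=
  max (frobNorm (featureMatrix d * (A - B)) / √(n : ℝ)) (frobNorm (sqrtMat S * (A - B))) ≤ ω₂ ∧
    rowNorm (A - B) ≤ ω₁

end

end LDARegression

/-! The proof separates a deterministic argument from a probabilistic one, and the set `goodSamples`
is the interface between them. A sample is good when its Gram matrix is at least half of `n` times
the population covariance, and when the noise `W = Y - XB`, projected onto the column space of `X`,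
has squared operator norm at most `n H`.

On a good sample, comparing the criterion at the estimate `A` and at `B` bounds `‖X(A - B)‖²` by
twice the inner product of `W` with `X(A - B)` plus `n λ (rank B - rank A)`. That inner product
costs only a factor `√(rank A + rank B)` (`noise_inner_sq_le`), so once `λ ≥ 2H` the penalty absorbs
`rank A` and leaves `4 n λ rank B` (`sum_sq_fit_le`). Gram domination transfers this to the
`Σ_W^{1/2}` norm, the eigenvalue bound to the Frobenius norm, and Cauchy–Schwarz over the `p` rows
to the row norm.

For the probability, the sample is realized as `μ_Y + Σ_W^{1/2} g` with `g` standard Gaussian and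
independent of the labels. Three quantities concentrate at relative level `t = K √((p + L) log n /
n)`: the label counts, the Gaussian Gram matrix, and the bilinear form coupling `g` with the labels,
the last two uniformly over directions by nets. The normal equations for `B` cancel the population
part of `Xᵀ W`, so only deviations remain (`sampleOf_mem_goodSamples`), with `H` of order `t² max
π_ℓ`, that is `(p + L) log n / (n L)`. Under the sample-size condition this ratio is at most its
square root, and `‖Σ_W‖_op ≥ c_W`, so the assumed penalty exceeds `2H`. -/

namespace LDARegression

/-! ### Nets of the unit ball -/

section Net

variable {E : Type*} [NormedAddCommGroup E] [NormedSpace ℝ E]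

/-- A maximal `1`-separated subset of the ball of radius `2`. -/
lemma exists_finset_cover_ball_two (E : Type*) [NormedAddCommGroup E] [NormedSpace ℝ E]
    [FiniteDimensional ℝ E] :
    ∃ N : Finset E, N.card ≤ 5 ^ Module.finrank ℝ E ∧ (∀ y ∈ N, ‖y‖ ≤ 2) ∧
      ∀ x : E, ‖x‖ ≤ 2 → ∃ y ∈ N, ‖x - y‖ ≤ 1 := by
  classical
  let P : ℕ → Prop := fun k => ∃ s : Finset E, s.card = k ∧ (∀ c ∈ s, ‖c‖ ≤ 2) ∧
    ∀ c ∈ s, ∀ d ∈ s, c ≠ d → 1 ≤ ‖c - d‖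
  have hP0 : P 0 := ⟨∅, by simp⟩
  -- The volume bound `5 ^ dim` caps every separated set, so a largest one exists; a point at
  -- distance more than 1 from it could be added.
  obtain ⟨s, hcard, hs, hsep⟩ : P (Nat.findGreatest P (5 ^ Module.finrank ℝ E)) :=
    Nat.findGreatest_spec (Nat.zero_le _) hP0
  refine ⟨s, Besicovitch.card_le_of_separated s hs hsep, hs, fun x hx => ?_⟩
  by_contra! hcon
  have hxs : x ∉ s := fun h => by
    have := hcon x h
    simp at this
    linarith
  have hins : P (s.card + 1) := by
    refine ⟨insert x s, Finset.card_insert_of_notMem hxs, ?_, ?_⟩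
    · intro c hc
      rcases Finset.mem_insert.1 hc with rfl | h
      exacts [hx, hs c h]
    · intro c hc d hd hcd
      rcases Finset.mem_insert.1 hc with rfl | h <;> rcases Finset.mem_insert.1 hd with rfl | h'
      · exact absurd rfl hcd
      · exact (hcon d h').le
      · rw [norm_sub_rev]; exact (hcon c h).le
      · exact hsep c h d h' hcd
  have hle : s.card + 1 ≤ 5 ^ Module.finrank ℝ E := by
    obtain ⟨s', h1, h2, h3⟩ := hins
    exact h1 ▸ Besicovitch.card_le_of_separated s' h2 h3
  have := Nat.le_findGreatest hle hins
  omega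

/-- A finite set of vectors of norm at most `2` that is within `1 / 4` of each point of the
unit ball, with cardinality exponential in the dimension. -/
lemma exists_quarter_net (E : Type*) [NormedAddCommGroup E] [NormedSpace ℝ E]
    [FiniteDimensional ℝ E] :
    ∃ N : Finset E, N.card ≤ 25 ^ Module.finrank ℝ E ∧ (∀ y ∈ N, ‖y‖ ≤ 2) ∧
      ∀ x : E, ‖x‖ ≤ 1 → ∃ y ∈ N, ‖x - y‖ ≤ 1 / 4 := by
  classical
  obtain ⟨N, hcard, hN, hcov⟩ := exists_finset_cover_ball_two E
  -- Two-stage refinement: `a` approximates `2x` within 1, then `b` approximates `2(2x - a)` within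
  -- 1, and `x - a/2 - b/4` is a quarter of the last error.
  refine ⟨(N ×ˢ N).image fun a => (1 / 2 : ℝ) • a.1 + (1 / 4 : ℝ) • a.2, ?_, ?_, ?_⟩
  · refine Finset.card_image_le.trans ?_
    rw [Finset.card_product, show 25 = 5 * 5 by norm_num, mul_pow]
    exact Nat.mul_le_mul hcard hcard
  · intro y hy
    obtain ⟨⟨a, b⟩, hab, rfl⟩ := Finset.mem_image.1 hy
    have ha := hN a (Finset.mem_product.1 hab).1
    have hb := hN b (Finset.mem_product.1 hab).2
    refine (norm_add_le _ _).trans ?_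
    rw [norm_smul, norm_smul]
    norm_num
    linarith
  · intro x hx
    obtain ⟨a, ha, hxa⟩ := hcov ((2 : ℝ) • x) (by rw [norm_smul]; norm_num; linarith)
    obtain ⟨b, hb, hxb⟩ := hcov ((2 : ℝ) • ((2 : ℝ) • x - a)) (by
      rw [norm_smul]; norm_num; linarith)
    refine ⟨_, Finset.mem_image.2 ⟨(a, b), Finset.mem_product.2 ⟨ha, hb⟩, rfl⟩, ?_⟩
    have : x - ((1 / 2 : ℝ) • a + (1 / 4 : ℝ) • b) =
        (1 / 4 : ℝ) • ((2 : ℝ) • ((2 : ℝ) • x - a) - b) := by module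
    rw [this, norm_smul]
    norm_num
    linarith

/-- A continuous bilinear form is controlled by its values on two nets. -/
lemma opNorm_le_of_net {F : Type*} [NormedAddCommGroup F] [NormedSpace ℝ F]
    (Q : E →L[ℝ] F →L[ℝ] ℝ) {N : Finset E} {M : Finset F} {s : ℝ} (hs : 0 ≤ s)
    (hN : ∀ y ∈ N, ‖y‖ ≤ 2) (hNc : ∀ x : E, ‖x‖ ≤ 1 → ∃ y ∈ N, ‖x - y‖ ≤ 1 / 4)
    (hMc : ∀ x : F, ‖x‖ ≤ 1 → ∃ y ∈ M, ‖x - y‖ ≤ 1 / 4)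
    (h : ∀ y ∈ N, ∀ z ∈ M, |Q y z| ≤ s) (x : E) (z : F) : |Q x z| ≤ 4 * s * ‖x‖ * ‖z‖ := by
  have hbound : ∀ x z, ‖x‖ ≤ 1 → ‖z‖ ≤ 1 → |Q x z| ≤ s + 3 / 4 * ‖Q‖ := by
    intro x z hx hz
    obtain ⟨y, hy, hxy⟩ := hNc x hx
    obtain ⟨w, hw, hzw⟩ := hMc z hz
    have h1 : |Q (x - y) z| ≤ ‖Q‖ * (1 / 4) * 1 :=
      (Q.le_opNorm₂ _ _).trans (by gcongr)
    have h2 : |Q y (z - w)| ≤ ‖Q‖ * 2 * (1 / 4) :=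
      (Q.le_opNorm₂ _ _).trans (by gcongr; exact hN y hy)
    have h3 := h y hy w hw
    have : Q x z = Q y w + Q (x - y) z + Q y (z - w) := by simp; ring
    rw [this]
    calc _ ≤ |Q y w| + |Q (x - y) z| + |Q y (z - w)| := abs_add_three _ _ _
      _ ≤ _ := by linarith
  -- The replacement errors are `1/4` and `2 · 1/4`, since net points may have norm 2. Their sum
  -- `3/4` is below 1, so the norm is absorbed at the price of the factor 4.
  have hscale : ‖Q‖ ≤ s + 3 / 4 * ‖Q‖ := by
    have h0 : 0 ≤ s + 3 / 4 * ‖Q‖ := by positivity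
    refine Q.opNorm_le_bound₂ h0 fun x z => ?_
    rcases eq_or_ne x 0 with rfl | hx
    · simp
    rcases eq_or_ne z 0 with rfl | hz
    · simp
    have := hbound (‖x‖⁻¹ • x) (‖z‖⁻¹ • z) (by simp [norm_smul, hx]) (by simp [norm_smul, hz])
    have hx' := norm_pos_iff.2 hx
    have hz' := norm_pos_iff.2 hz
    have e : Q x z = ‖x‖ * ‖z‖ * Q (‖x‖⁻¹ • x) (‖z‖⁻¹ • z) := by
      simp; field_simp
    rw [Real.norm_eq_abs, e, abs_mul, abs_of_pos (mul_pos hx' hz')]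
    calc _ ≤ ‖x‖ * ‖z‖ * (s + 3 / 4 * ‖Q‖) := by gcongr
      _ = _ := by ring
  have := Q.le_opNorm₂ x z
  rw [Real.norm_eq_abs] at this
  refine this.trans ?_
  gcongr
  linarith

end Net

/-! ### Exponential inequalities -/

/-- Chernoff's bound for a sum of functions of the coordinates of a product measure. -/
lemma chernoff_pi {ι α : Type*} [Fintype ι] [MeasurableSpace α] (m : Measure α)
    [IsProbabilityMeasure m] (f : ι → α → ℝ) (ψ : ι → ℝ)
    (hint : ∀ i, Integrable (fun a => Real.exp (f i a)) m)
    (hψ : ∀ i, ∫ a, Real.exp (f i a) ∂m ≤ Real.exp (ψ i)) (s : ℝ) :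
    (Measure.pi fun _ : ι => m).real {x | s ≤ ∑ i, f i (x i)} ≤ Real.exp (∑ i, ψ i - s) := by
  have hI : Integrable (fun x : ι → α => Real.exp (1 * ∑ i, f i (x i)))
      (Measure.pi fun _ : ι => m) := by
    simp only [one_mul, Real.exp_sum]
    exact Integrable.fintype_prod (f := fun i a => Real.exp (f i a)) hint
  have := measure_ge_le_exp_mul_mgf (μ := Measure.pi fun _ : ι => m)
    (X := fun x : ι → α => ∑ i, f i (x i)) s zero_le_one hI
  refine this.trans ?_
  rw [sub_eq_neg_add, Real.exp_add, neg_mul, one_mul]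
  gcongr
  simp only [mgf, one_mul, Real.exp_sum]
  rw [integral_fintype_prod_eq_prod (f := fun i a => Real.exp (f i a))]
  exact Finset.prod_le_prod (fun i _ => integral_nonneg fun a => (Real.exp_pos _).le)
    fun i _ => hψ i

/-- The exponential moment of a centred indicator. -/
lemma integral_exp_indicator_le {α : Type*} [MeasurableSpace α] (m : Measure α)
    [IsProbabilityMeasure m] {A : Set α} (hA : MeasurableSet A) {θ : ℝ} (hθ : |θ| ≤ 1) :
    Integrable (fun a => Real.exp (θ * (A.indicator 1 a - m.real A))) m ∧
    ∫ a, Real.exp (θ * (A.indicator 1 a - m.real A)) ∂m ≤ Real.exp (m.real A * θ ^ 2) := by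
  have e : (fun a => Real.exp (θ * (A.indicator 1 a - m.real A))) = fun a =>
      Real.exp (-(θ * m.real A)) * (1 + A.indicator (fun _ => Real.exp θ - 1) a) := by
    ext a
    by_cases h : a ∈ A
    · simp [h, ← Real.exp_add]; ring_nf
    · simp [h]
  have hi : Integrable (fun a => A.indicator (fun _ => Real.exp θ - 1) a) m :=
    (integrable_const _).indicator hA
  rw [e]
  refine ⟨((integrable_const _).add hi).const_mul _, ?_⟩
  rw [integral_const_mul, integral_add (integrable_const _) hi, integral_indicator_const _ hA]
  simp only [integral_const, probReal_univ, smul_eq_mul, mul_one]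
  have h1 : Real.exp θ - 1 ≤ θ + θ ^ 2 := by
    have := Real.abs_exp_sub_one_sub_id_le hθ
    linarith [(abs_le.1 this).2]
  have h2 : 1 + m.real A * (Real.exp θ - 1) ≤ Real.exp (m.real A * (θ + θ ^ 2)) := by
    have := Real.add_one_le_exp (m.real A * (θ + θ ^ 2))
    have h3 : m.real A * (Real.exp θ - 1) ≤ m.real A * (θ + θ ^ 2) := by
      gcongr
    linarith
  calc _ ≤ Real.exp (-(θ * m.real A)) * Real.exp (m.real A * (θ + θ ^ 2)) := by gcongr
    _ = _ := by rw [← Real.exp_add]; ring_nf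

/-- The exponential moment of a centred squared standard normal variable. -/
lemma integral_exp_sq_gaussianReal_le {a : ℝ} (ha : |a| ≤ 1 / 4) :
    Integrable (fun x => Real.exp (a * (x ^ 2 - 1))) (gaussianReal 0 1) ∧
    ∫ x, Real.exp (a * (x ^ 2 - 1)) ∂(gaussianReal 0 1) ≤ Real.exp (4 * a ^ 2) := by
  have ha' := abs_le.1 ha
  have hb : 0 < 1 / 2 - a := by linarith
  have key : ∀ x : ℝ, gaussianPDFReal 0 1 x * Real.exp (a * (x ^ 2 - 1)) =
      (√(2 * Real.pi))⁻¹ * Real.exp (-a) * Real.exp (-(1 / 2 - a) * x ^ 2) := by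
    intro x
    simp only [gaussianPDFReal, NNReal.coe_one, mul_one, sub_zero]
    rw [mul_assoc, mul_assoc, ← Real.exp_add, ← Real.exp_add]
    ring_nf
  constructor
  · rw [gaussianReal_of_var_ne_zero _ one_ne_zero,
      integrable_withDensity_iff_integrable_smul₀' (by fun_prop) (by simp [gaussianPDF])]
    simp only [gaussianPDF, ENNReal.toReal_ofReal (gaussianPDFReal_nonneg _ _ _), smul_eq_mul, key]
    exact (integrable_exp_neg_mul_sq hb).const_mul _
  · rw [integral_gaussianReal_eq_integral_smul one_ne_zero]
    simp only [smul_eq_mul, key]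
    rw [integral_const_mul, integral_gaussian]
    have h1 : (√(2 * Real.pi))⁻¹ * Real.exp (-a) * √(Real.pi / (1 / 2 - a)) =
        Real.exp (-a) * √((1 - 2 * a)⁻¹) := by
      have : Real.pi / (1 / 2 - a) = (2 * Real.pi) * (1 - 2 * a)⁻¹ := by
        have : 1 - 2 * a ≠ 0 := by linarith
        field_simp
      have h0 : √(2 * Real.pi) ≠ 0 := by positivity
      rw [this, Real.sqrt_mul (show 0 ≤ 2 * Real.pi by positivity) (1 - 2 * a)⁻¹,
        mul_comm _ (Real.exp (-a)), mul_assoc, inv_mul_cancel_left₀ h0]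
    rw [h1]
    -- The integral equals `exp(-a) (1 - 2a)^{-1/2}`. In its logarithm the linear terms cancel, and
    -- the remainder of the logarithmic series is quadratic in `a`.
    have hx : |2 * a| ≤ 1 / 2 := by rw [abs_mul]; norm_num; linarith
    have h2 := Real.abs_log_sub_add_sum_range_le (x := 2 * a) (by linarith) 1
    simp at h2
    have h3 : (2 * |a|) ^ 2 / (1 - 2 * |a|) ≤ 8 * a ^ 2 := by
      rw [div_le_iff₀ (by linarith), mul_pow, sq_abs]
      nlinarith [sq_nonneg a]
    have hpos : 0 < 1 - 2 * a := by linarith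
    have h4 : -Real.log (1 - 2 * a) ≤ 2 * a + 8 * a ^ 2 := by
      have := (abs_le.1 h2).1
      linarith
    have h5 : √((1 - 2 * a)⁻¹) ≤ Real.exp (a + 4 * a ^ 2) := by
      rw [Real.sqrt_le_left (Real.exp_pos _).le, ← Real.exp_nat_mul]
      rw [← Real.exp_log (inv_pos.2 hpos), Real.log_inv]
      apply Real.exp_le_exp.2
      push_cast
      linarith
    calc _ ≤ Real.exp (-a) * Real.exp (a + 4 * a ^ 2) := by gcongr
      _ = _ := by rw [← Real.exp_add]; ring_nf

section StdGaussian

variable {E : Type*} [NormedAddCommGroup E] [InnerProductSpace ℝ E] [FiniteDimensional ℝ E]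
  [MeasurableSpace E] [BorelSpace E]

/-- A linear functional of a standard Gaussian vector is a centred normal variable. -/
lemma map_inner_stdGaussian (h : E) :
    (stdGaussian E).map (fun g => inner ℝ h g) = (gaussianReal 0 1).map (fun x => ‖h‖ * x) := by
  have h1 := IsGaussian.map_eq_gaussianReal (μ := stdGaussian E) (innerSL ℝ h)
  rw [integral_strongDual_stdGaussian, variance_dual_stdGaussian, innerSL_apply_norm] at h1
  have : (fun g => inner ℝ h g) = ⇑(innerSL ℝ h) := rfl
  rw [this, h1, gaussianReal_map_const_mul]
  congr 1
  · simp
  · ext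
    simp

lemma integral_exp_inner_stdGaussian (h : E) :
    Integrable (fun g => Real.exp (inner ℝ h g)) (stdGaussian E) ∧
    ∫ g, Real.exp (inner ℝ h g) ∂(stdGaussian E) = Real.exp (‖h‖ ^ 2 / 2) := by
  have hm : AEMeasurable (fun g => inner ℝ h g) (stdGaussian E) := by fun_prop
  constructor
  · have : Integrable Real.exp ((stdGaussian E).map fun g => inner ℝ h g) := by
      rw [map_inner_stdGaussian, integrable_map_measure (by fun_prop) (by fun_prop)]
      exact integrable_exp_mul_gaussianReal _
    exact (integrable_map_measure (by fun_prop) hm).1 this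
  · rw [← integral_map (f := Real.exp) hm (by fun_prop), map_inner_stdGaussian,
      integral_map (by fun_prop) (by fun_prop)]
    have := congrFun (mgf_id_gaussianReal (μ := 0) (v := 1)) ‖h‖
    simp only [mgf, id] at this
    rw [this]
    simp

/-- The inner product is `‖h‖` times a standard normal, so the one-dimensional bound applies with `a
= θ ‖h‖²`. -/
lemma integral_exp_inner_sq_stdGaussian_le (h : E) {θ : ℝ} (hθ : |θ| * ‖h‖ ^ 2 ≤ 1 / 4) :
    Integrable (fun g => Real.exp (θ * ((inner ℝ h g) ^ 2 - ‖h‖ ^ 2))) (stdGaussian E) ∧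
    ∫ g, Real.exp (θ * ((inner ℝ h g) ^ 2 - ‖h‖ ^ 2)) ∂(stdGaussian E) ≤
      Real.exp (4 * θ ^ 2 * ‖h‖ ^ 4) := by
  have hm : AEMeasurable (fun g => inner ℝ h g) (stdGaussian E) := by fun_prop
  have ha : |θ * ‖h‖ ^ 2| ≤ 1 / 4 := by
    rwa [abs_mul, abs_of_nonneg (sq_nonneg ‖h‖)]
  have hc : (fun x : ℝ => Real.exp (θ * ((‖h‖ * x) ^ 2 - ‖h‖ ^ 2))) =
      fun x => Real.exp (θ * ‖h‖ ^ 2 * (x ^ 2 - 1)) := by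
    ext x; ring_nf
  obtain ⟨h1, h2⟩ := integral_exp_sq_gaussianReal_le ha
  constructor
  · have : Integrable (fun y => Real.exp (θ * (y ^ 2 - ‖h‖ ^ 2)))
        ((stdGaussian E).map fun g => inner ℝ h g) := by
      rw [map_inner_stdGaussian, integrable_map_measure (by fun_prop) (by fun_prop)]
      simpa only [Function.comp_def, hc] using h1
    exact (integrable_map_measure (by fun_prop) hm).1 this
  · rw [← integral_map (f := fun y => Real.exp (θ * (y ^ 2 - ‖h‖ ^ 2))) hm (by fun_prop),
      map_inner_stdGaussian, integral_map (by fun_prop) (by fun_prop), hc]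
    refine h2.trans (le_of_eq ?_)
    ring_nf

end StdGaussian

/-! ### Uniform deviation bounds for Gaussian matrices and label counts -/

section GaussianMatrices

variable {E : Type*} [NormedAddCommGroup E] [InnerProductSpace ℝ E] [FiniteDimensional ℝ E]
  [MeasurableSpace E] [BorelSpace E]

/-- Chernoff's bound for a single direction. Norms up to 4 are allowed because the polarization step
applies it to sums and differences of two net points. -/
lemma stdGaussian_pi_sq_tail {n : ℕ} (u : E) (hu : ‖u‖ ≤ 4) {t : ℝ} (ht0 : 0 ≤ t) (ht1 : t ≤ 1) :
    (Measure.pi fun _ : Fin n => stdGaussian E).real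
      {g | n * t / 2 ≤ |∑ i, (inner ℝ u (g i) ^ 2 - ‖u‖ ^ 2)|} ≤
      2 * Real.exp (-(n * t ^ 2 / 16384)) := by
  have hu2 : ‖u‖ ^ 2 ≤ 16 := by nlinarith [norm_nonneg u]
  have hu4 : ‖u‖ ^ 4 ≤ 256 := by nlinarith [sq_nonneg ‖u‖]
  -- The tilt turns the threshold `nt/2` into `nt²/8192`. The exponential moment costs at most `4 ·
  -- 256 · n(t/4096)² = nt²/16384`, half of that.
  have one_side : ∀ θ : ℝ, |θ| = t / 4096 →
      (Measure.pi fun _ : Fin n => stdGaussian E).real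
        {g | n * t ^ 2 / 8192 ≤ ∑ i, θ * (inner ℝ u (g i) ^ 2 - ‖u‖ ^ 2)} ≤
      Real.exp (-(n * t ^ 2 / 16384)) := by
    intro θ hθ
    have hθ' : |θ| * ‖u‖ ^ 2 ≤ 1 / 4 := by
      rw [hθ]; nlinarith [sq_nonneg ‖u‖]
    have := chernoff_pi (stdGaussian E) (fun (_ : Fin n) g => θ * (inner ℝ u g ^ 2 - ‖u‖ ^ 2))
      (fun _ => 4 * θ ^ 2 * ‖u‖ ^ 4) (fun _ => (integral_exp_inner_sq_stdGaussian_le u hθ').1)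
      (fun _ => (integral_exp_inner_sq_stdGaussian_le u hθ').2) (n * t ^ 2 / 8192)
    refine this.trans (Real.exp_le_exp.2 ?_)
    have hsq : θ ^ 2 = (t / 4096) ^ 2 := by rw [← hθ, sq_abs]
    have : (n : ℝ) * (4 * (t / 4096) ^ 2 * ‖u‖ ^ 4) ≤ n * (4 * (t / 4096) ^ 2 * 256) := by
      gcongr
    simp only [Finset.sum_const, Finset.card_univ, Fintype.card_fin, nsmul_eq_mul, hsq]
    linarith
  have hsub : {g : Fin n → E | n * t / 2 ≤ |∑ i, (inner ℝ u (g i) ^ 2 - ‖u‖ ^ 2)|} ⊆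
      {g | n * t ^ 2 / 8192 ≤ ∑ i, t / 4096 * (inner ℝ u (g i) ^ 2 - ‖u‖ ^ 2)} ∪
      {g | n * t ^ 2 / 8192 ≤ ∑ i, -(t / 4096) * (inner ℝ u (g i) ^ 2 - ‖u‖ ^ 2)} := by
    intro g hg
    simp only [Set.mem_union, Set.mem_ofPred_eq, ← Finset.mul_sum] at hg ⊢
    rcases le_abs.1 hg with h | h
    · left; nlinarith
    · right; nlinarith
  refine (measureReal_mono hsub (measure_ne_top _ _)).trans ((measureReal_union_le _ _).trans ?_)
  have h1 := one_side (t / 4096) (abs_of_nonneg (by positivity))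
  have h2 := one_side (-(t / 4096)) (by rw [abs_neg, abs_of_nonneg (by positivity)])
  linarith

/-- The empirical second moments of standard Gaussian vectors, uniformly over all directions. -/
lemma stdGaussian_pi_covariance_tail {n : ℕ} {t : ℝ} (ht0 : 0 ≤ t) (ht1 : t ≤ 1) :
    (Measure.pi fun _ : Fin n => stdGaussian E).real
      {g | ¬ ∀ h h' : E, |∑ i, inner ℝ h (g i) * inner ℝ h' (g i) - n * inner ℝ h h'| ≤
        n * t * ‖h‖ * ‖h'‖} ≤
      (25 ^ Module.finrank ℝ E * 25 ^ Module.finrank ℝ E) *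
        (4 * Real.exp (-(n * t ^ 2 / 16384))) := by
  classical
  obtain ⟨N, hcard, hN, hcov⟩ := exists_quarter_net E
  let A : E → Set (Fin n → E) := fun u =>
    {g | n * t / 2 ≤ |∑ i, (inner ℝ u (g i) ^ 2 - ‖u‖ ^ 2)|}
  have hsub : {g : Fin n → E | ¬ ∀ h h' : E,
      |∑ i, inner ℝ h (g i) * inner ℝ h' (g i) - n * inner ℝ h h'| ≤ n * t * ‖h‖ * ‖h'‖} ⊆
      ⋃ a ∈ N ×ˢ N, A (a.1 + a.2) ∪ A (a.1 - a.2) := by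
    intro g hg
    by_contra hcon
    apply hg
    have hcon' : ∀ y ∈ N, ∀ z ∈ N, g ∉ A (y + z) ∧ g ∉ A (y - z) := by
      intro y hy z hz
      by_contra hc
      refine hcon (Set.mem_biUnion (x := (y, z)) (Finset.mem_product.2 ⟨hy, hz⟩) ?_)
      by_contra hc'
      exact hc ⟨fun h => hc' (Or.inl h), fun h => hc' (Or.inr h)⟩
    have hbil : IsBilinearMap ℝ fun h h' : E =>
        ∑ i, inner ℝ h (g i) * inner ℝ h' (g i) - n * inner ℝ h h' := by
      constructor <;> intros <;>
        simp only [inner_add_left, inner_add_right, real_inner_smul_left, real_inner_smul_right,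
          add_mul, mul_add, Finset.sum_add_distrib, smul_eq_mul, mul_sub, Finset.mul_sum]
      · ring
      · congr 1
        · exact Finset.sum_congr rfl fun _ _ => by ring
        · ring
      · ring
      · congr 1
        · exact Finset.sum_congr rfl fun _ _ => by ring
        · ring
    intro h h'
    have key := opNorm_le_of_net hbil.toContinuousBilinearMap (s := n * t / 4) (by positivity)
      hN hcov hcov (M := N) ?_ h h'
    · rw [IsBilinearMap.toContinuousBilinearMap_apply] at key
      refine key.trans (le_of_eq ?_)
      ring
    · intro y hy z hz
      rw [IsBilinearMap.toContinuousBilinearMap_apply]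
      obtain ⟨h1, h2⟩ := hcon' y hy z hz
      simp only [A, Set.mem_ofPred_eq, not_le] at h1 h2
      -- Polarization reduces mixed moments to squares; two deviations of `nt/2`, weighted by `1/4`,
      -- give the `nt/4` required on the net.
      have hpol : ∑ i, inner ℝ y (g i) * inner ℝ z (g i) - n * inner ℝ y z =
          1 / 4 * (∑ i, (inner ℝ (y + z) (g i) ^ 2 - ‖y + z‖ ^ 2) -
            ∑ i, (inner ℝ (y - z) (g i) ^ 2 - ‖y - z‖ ^ 2)) := by
        rw [← Finset.sum_sub_distrib]
        have : ∀ i, (inner ℝ (y + z) (g i) ^ 2 - ‖y + z‖ ^ 2) -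
            (inner ℝ (y - z) (g i) ^ 2 - ‖y - z‖ ^ 2) =
            4 * (inner ℝ y (g i) * inner ℝ z (g i)) - 4 * inner ℝ y z := by
          intro i
          rw [inner_add_left, inner_sub_left, norm_add_sq_real, norm_sub_sq_real]
          ring
        simp only [this, Finset.sum_sub_distrib, ← Finset.mul_sum, Finset.sum_const,
          Finset.card_univ, Fintype.card_fin, nsmul_eq_mul]
        ring
      rw [hpol, abs_mul, abs_of_pos (show (0 : ℝ) < 1 / 4 by norm_num)]
      have := abs_sub (∑ i, (inner ℝ (y + z) (g i) ^ 2 - ‖y + z‖ ^ 2))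
        (∑ i, (inner ℝ (y - z) (g i) ^ 2 - ‖y - z‖ ^ 2))
      linarith
  refine (measureReal_mono hsub (measure_ne_top _ _)).trans
    ((measureReal_biUnion_finset_le _ _).trans ?_)
  have hterm : ∀ a ∈ N ×ˢ N, (Measure.pi fun _ : Fin n => stdGaussian E).real
      (A (a.1 + a.2) ∪ A (a.1 - a.2)) ≤ 4 * Real.exp (-(n * t ^ 2 / 16384)) := by
    intro a ha
    have h1 := hN _ (Finset.mem_product.1 ha).1
    have h2 := hN _ (Finset.mem_product.1 ha).2
    have h3 := stdGaussian_pi_sq_tail (n := n) (a.1 + a.2)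
      ((norm_add_le _ _).trans (by linarith)) ht0 ht1
    have h4 := stdGaussian_pi_sq_tail (n := n) (a.1 - a.2)
      ((norm_sub_le _ _).trans (by linarith)) ht0 ht1
    refine (measureReal_union_le _ _).trans ?_
    linarith
  refine (Finset.sum_le_card_nsmul _ _ _ hterm).trans ?_
  rw [nsmul_eq_mul, Finset.card_product]
  push_cast
  have hc : (N.card : ℝ) ≤ 25 ^ Module.finrank ℝ E := by exact_mod_cast hcard
  gcongr

/-- A Gaussian bilinear form, uniformly over all pairs of directions. -/
lemma stdGaussian_pi_bilinear_tail {F : Type*} [NormedAddCommGroup F] [NormedSpace ℝ F]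
    [FiniteDimensional ℝ F] {n : ℕ} (a : F →ₗ[ℝ] Fin n → ℝ)
    (ha : ∀ w, ∑ i, a w i ^ 2 ≤ 2 * n * ‖w‖ ^ 2) {t : ℝ} (ht0 : 0 ≤ t) :
    (Measure.pi fun _ : Fin n => stdGaussian E).real
      {g | ¬ ∀ (h : E) (w : F), |∑ i, inner ℝ h (g i) * a w i| ≤ n * t * ‖h‖ * ‖w‖} ≤
      (25 ^ Module.finrank ℝ E * 25 ^ Module.finrank ℝ F) *
        (2 * Real.exp (-(n * t ^ 2 / 1024))) := by
  classical
  obtain ⟨N, hcard, hN, hcov⟩ := exists_quarter_net E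
  obtain ⟨M, hcardM, hM, hcovM⟩ := exists_quarter_net F
  let A : E × F → Set (Fin n → E) := fun u =>
    {g | n * t / 4 ≤ |∑ i, inner ℝ u.1 (g i) * a u.2 i|}
  have hsub : {g : Fin n → E | ¬ ∀ (h : E) (w : F),
      |∑ i, inner ℝ h (g i) * a w i| ≤ n * t * ‖h‖ * ‖w‖} ⊆ ⋃ u ∈ N ×ˢ M, A u := by
    intro g hg
    by_contra hcon
    apply hg
    have hbil : IsBilinearMap ℝ fun (h : E) (w : F) => ∑ i, inner ℝ h (g i) * a w i := by
      constructor <;> intros <;>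
        simp only [inner_add_left, real_inner_smul_left, map_add, map_smul, Pi.add_apply,
          Pi.smul_apply, add_mul, mul_add, Finset.sum_add_distrib, smul_eq_mul, Finset.mul_sum]
      · exact Finset.sum_congr rfl fun _ _ => by ring
      · exact Finset.sum_congr rfl fun _ _ => by ring
    intro h w
    have key := opNorm_le_of_net hbil.toContinuousBilinearMap (s := n * t / 4) (by positivity)
      hN hcov hcovM ?_ h w
    · rw [IsBilinearMap.toContinuousBilinearMap_apply] at key
      refine key.trans (le_of_eq ?_)
      ring
    · intro y hy z hz
      rw [IsBilinearMap.toContinuousBilinearMap_apply]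
      by_contra hc
      exact hcon (Set.mem_biUnion (x := (y, z)) (Finset.mem_product.2 ⟨hy, hz⟩) (not_le.1 hc).le)
  refine (measureReal_mono hsub (measure_ne_top _ _)).trans
    ((measureReal_biUnion_finset_le _ _).trans ?_)
  have hterm : ∀ u ∈ N ×ˢ M, (Measure.pi fun _ : Fin n => stdGaussian E).real (A u) ≤
      2 * Real.exp (-(n * t ^ 2 / 1024)) := by
    rintro ⟨h, w⟩ hu
    have hh := hN _ (Finset.mem_product.1 hu).1
    have hw := hM _ (Finset.mem_product.1 hu).2
    simp only at hh hw
    -- With the weights fixed the sum is Gaussian. The tilted threshold is `nt²/512`, and the bounds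
    -- `‖h‖, ‖w‖ ≤ 2` limit the moment exponent to `nt²/1024`.
    have one_side : ∀ θ : ℝ, |θ| = t / 128 → (Measure.pi fun _ : Fin n => stdGaussian E).real
        {g | n * t ^ 2 / 512 ≤ ∑ i, inner ℝ ((θ * a w i) • h) (g i)} ≤
        Real.exp (-(n * t ^ 2 / 1024)) := by
      intro θ hθ
      have := chernoff_pi (stdGaussian E) (fun (i : Fin n) g => inner ℝ ((θ * a w i) • h) g)
        (fun i => ‖(θ * a w i) • h‖ ^ 2 / 2) (fun i => (integral_exp_inner_stdGaussian _).1)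
        (fun i => (integral_exp_inner_stdGaussian _).2.le) (n * t ^ 2 / 512)
      refine this.trans (Real.exp_le_exp.2 ?_)
      have hsum : ∑ i, ‖(θ * a w i) • h‖ ^ 2 / 2 = (t / 128) ^ 2 * ‖h‖ ^ 2 / 2 *
          ∑ i, a w i ^ 2 := by
        rw [Finset.mul_sum]
        refine Finset.sum_congr rfl fun i _ => ?_
        rw [norm_smul, Real.norm_eq_abs, abs_mul, mul_pow, mul_pow, hθ, sq_abs]
        ring
      rw [hsum]
      have h1 : (t / 128) ^ 2 * ‖h‖ ^ 2 / 2 * ∑ i, a w i ^ 2 ≤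
          (t / 128) ^ 2 * 2 ^ 2 / 2 * (2 * n * 2 ^ 2) := by
        have := ha w
        gcongr
        refine this.trans ?_
        gcongr
      linarith
    have hs : A (h, w) ⊆
        {g | n * t ^ 2 / 512 ≤ ∑ i, inner ℝ ((t / 128 * a w i) • h) (g i)} ∪
        {g | n * t ^ 2 / 512 ≤ ∑ i, inner ℝ ((-(t / 128) * a w i) • h) (g i)} := by
      intro g hg
      simp only [A, Set.mem_union, Set.mem_ofPred_eq, real_inner_smul_left] at hg ⊢
      have e : ∀ θ : ℝ, ∑ i, θ * a w i * inner ℝ h (g i) =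
          θ * ∑ i, inner ℝ h (g i) * a w i := by
        intro θ
        rw [Finset.mul_sum]
        exact Finset.sum_congr rfl fun _ _ => by ring
      rw [e, e]
      rcases le_abs.1 hg with h | h
      · left; nlinarith
      · right; nlinarith
    refine (measureReal_mono hs (measure_ne_top _ _)).trans ((measureReal_union_le _ _).trans ?_)
    have h1 := one_side (t / 128) (abs_of_nonneg (by positivity))
    have h2 := one_side (-(t / 128)) (by rw [abs_neg, abs_of_nonneg (by positivity)])
    linarith
  refine (Finset.sum_le_card_nsmul _ _ _ hterm).trans ?_
  rw [nsmul_eq_mul, Finset.card_product]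
  push_cast
  have hc : (N.card : ℝ) ≤ 25 ^ Module.finrank ℝ E := by exact_mod_cast hcard
  have hc' : (M.card : ℝ) ≤ 25 ^ Module.finrank ℝ F := by exact_mod_cast hcardM
  gcongr

end GaussianMatrices

/-- The relative frequencies of the labels of an i.i.d. sample. -/
lemma pi_count_tail {n L : ℕ} (κ : Measure (Fin L)) [IsProbabilityMeasure κ] {m : ℝ}
    (hm : ∀ ℓ, m ≤ κ.real {ℓ}) {t : ℝ} (ht0 : 0 ≤ t) (ht1 : t ≤ 1) :
    (Measure.pi fun _ : Fin n => κ).real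
      {y | ¬ ∀ ℓ, |∑ i, (if y i = ℓ then (1 : ℝ) else 0) - n * κ.real {ℓ}| ≤
        t * (n * κ.real {ℓ})} ≤
      L * (2 * Real.exp (-(n * m * t ^ 2 / 4))) := by
  classical
  let A : Fin L → Set (Fin n → Fin L) := fun ℓ =>
    {y | t * (n * κ.real {ℓ}) ≤ |∑ i, (if y i = ℓ then (1 : ℝ) else 0) - n * κ.real {ℓ}|}
  have hsub : {y : Fin n → Fin L | ¬ ∀ ℓ,
      |∑ i, (if y i = ℓ then (1 : ℝ) else 0) - n * κ.real {ℓ}| ≤ t * (n * κ.real {ℓ})} ⊆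
      ⋃ ℓ ∈ Finset.univ, A ℓ := by
    intro y hy
    simp only [Set.mem_ofPred_eq, not_forall, not_le] at hy
    obtain ⟨ℓ, h⟩ := hy
    exact Set.mem_biUnion (Finset.mem_univ ℓ) h.le
  refine (measureReal_mono hsub (measure_ne_top _ _)).trans
    ((measureReal_biUnion_finset_le _ _).trans ?_)
  have hterm : ∀ ℓ ∈ Finset.univ, (Measure.pi fun _ : Fin n => κ).real (A ℓ) ≤
      2 * Real.exp (-(n * m * t ^ 2 / 4)) := by
    intro ℓ _
    have one_side : ∀ θ : ℝ, |θ| = t / 2 → (Measure.pi fun _ : Fin n => κ).real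
        {y | n * κ.real {ℓ} * t ^ 2 / 2 ≤
          ∑ i, θ * (Set.indicator {ℓ} 1 (y i) - κ.real {ℓ})} ≤
        Real.exp (-(n * m * t ^ 2 / 4)) := by
      intro θ hθ
      have hb := integral_exp_indicator_le κ (measurableSet_singleton ℓ) (θ := θ)
        (by rw [hθ]; linarith)
      have := chernoff_pi κ (fun (_ : Fin n) a => θ * (Set.indicator {ℓ} 1 a - κ.real {ℓ}))
        (fun _ => κ.real {ℓ} * θ ^ 2) (fun _ => hb.1) (fun _ => hb.2)
        (n * κ.real {ℓ} * t ^ 2 / 2)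
      refine this.trans (Real.exp_le_exp.2 ?_)
      have hsq : θ ^ 2 = (t / 2) ^ 2 := by rw [← hθ, sq_abs]
      simp only [Finset.sum_const, Finset.card_univ, Fintype.card_fin, nsmul_eq_mul, hsq]
      have : n * m * t ^ 2 ≤ n * κ.real {ℓ} * t ^ 2 := by
        have := hm ℓ
        gcongr
      linarith
    have hs : A ℓ ⊆
        {y | n * κ.real {ℓ} * t ^ 2 / 2 ≤
          ∑ i, t / 2 * (Set.indicator {ℓ} 1 (y i) - κ.real {ℓ})} ∪
        {y | n * κ.real {ℓ} * t ^ 2 / 2 ≤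
          ∑ i, -(t / 2) * (Set.indicator {ℓ} 1 (y i) - κ.real {ℓ})} := by
      intro y hy
      have e : ∑ i, (Set.indicator {ℓ} (1 : Fin L → ℝ) (y i) - κ.real {ℓ}) =
          ∑ i, (if y i = ℓ then (1 : ℝ) else 0) - n * κ.real {ℓ} := by
        simp [Finset.sum_sub_distrib, Set.indicator_apply]
      simp only [A, Set.mem_union, Set.mem_ofPred_eq, ← Finset.mul_sum, e] at hy ⊢
      rcases le_abs.1 hy with h | h
      · left; nlinarith
      · right; nlinarith
    refine (measureReal_mono hs (measure_ne_top _ _)).trans ((measureReal_union_le _ _).trans ?_)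
    have h1 := one_side (t / 2) (abs_of_nonneg (by positivity))
    have h2 := one_side (-(t / 2)) (by rw [abs_neg, abs_of_nonneg (by positivity)])
    linarith
  refine (Finset.sum_le_card_nsmul _ _ _ hterm).trans ?_
  simp

/-! ### The discriminant model: mixture representation and population moments -/

noncomputable section

/-- The operator on Euclidean space given by `S^{1/2}`. -/
def sqrtOp {p : ℕ} (S : Matrix (Fin p) (Fin p) ℝ) :
    EuclideanSpace ℝ (Fin p) →L[ℝ] EuclideanSpace ℝ (Fin p) :=
  Matrix.toEuclideanCLM (𝕜 := ℝ) (sqrtMat S)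

open scoped MatrixOrder in
lemma inner_sqrtOp {p : ℕ} {S : Matrix (Fin p) (Fin p) ℝ} (hS : S.PosSemidef)
    (x y : EuclideanSpace ℝ (Fin p)) :
    inner ℝ (sqrtOp S x) (sqrtOp S y) = x.ofLp ⬝ᵥ S.mulVec y.ofLp := by
  have hsa : IsSelfAdjoint (sqrtOp S) := (CFC.sqrt_nonneg S).isSelfAdjoint.map _
  rw [← hsa.adjoint_eq, ContinuousLinearMap.adjoint_inner_left, hsa.adjoint_eq,
    ← ContinuousLinearMap.comp_apply, ← ContinuousLinearMap.mul_def]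
  unfold sqrtOp sqrtMat
  rw [← map_mul, CFC.sqrt_mul_sqrt_self _ hS.nonneg, Matrix.inner_toEuclideanCLM]

lemma multivariateGaussian_eq_map {p : ℕ} (m : EuclideanSpace ℝ (Fin p))
    (S : Matrix (Fin p) (Fin p) ℝ) :
    multivariateGaussian m S =
      (stdGaussian (EuclideanSpace ℝ (Fin p))).map fun g => m + sqrtOp S g := rfl

namespace IsLDALaw

variable {p L : ℕ} {ν : Measure (Obs p L)} {prior : Fin L → ℝ}
  {μ : Fin L → EuclideanSpace ℝ (Fin p)} {S : Matrix (Fin p) (Fin p) ℝ}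

/-- Total probability over the label. This turns the conditional laws into an explicit mixture, the
source of both the moments and the sampling representation. -/
lemma apply_eq_sum (h : IsLDALaw ν prior μ S) {s : Set (Obs p L)} (hs : MeasurableSet s) :
    ν s = ∑ ℓ, ENNReal.ofReal (prior ℓ) *
      multivariateGaussian (μ ℓ) S ((fun x => (x, ℓ)) ⁻¹' s) := by
  have := h.isProbabilityMeasure
  have hm : ∀ ℓ : Fin L, MeasurableSet (Prod.snd ⁻¹' {ℓ} : Set (Obs p L)) := fun ℓ =>
    measurable_snd (measurableSet_singleton ℓ)
  have hdec : ν s = ∑ ℓ, ν (Prod.snd ⁻¹' {ℓ} ∩ s) := by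
    rw [← measure_biUnion_finset]
    · congr 1
      ext z
      simp
    · intro a _ b _ hab
      refine Set.disjoint_left.2 fun z hz hz' => hab ?_
      simp only [Set.mem_inter_iff, Set.mem_preimage, Set.mem_singleton_iff] at hz hz'
      exact hz.1.symm.trans hz'.1
    · exact fun ℓ _ => (hm ℓ).inter hs
  rw [hdec]
  refine Finset.sum_congr rfl fun ℓ _ => ?_
  have e : Prod.snd ⁻¹' {ℓ} ∩ s = Prod.snd ⁻¹' {ℓ} ∩ Prod.fst ⁻¹' ((fun x => (x, ℓ)) ⁻¹' s) := by
    ext ⟨x, k⟩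
    simp only [Set.mem_inter_iff, Set.mem_preimage, Set.mem_singleton_iff]
    constructor <;> rintro ⟨rfl, hx⟩ <;> exact ⟨rfl, hx⟩
  rw [e, ← cond_mul_eq_inter (hm ℓ), ← h.cond_feature, ← h.prob_label, ofReal_measureReal,
    Measure.map_apply measurable_fst (measurable_prodMk_right hs), mul_comm]

lemma eq_sum (h : IsLDALaw ν prior μ S) :
    ν = ∑ ℓ, ENNReal.ofReal (prior ℓ) •
      (multivariateGaussian (μ ℓ) S).map (fun x => ((x, ℓ) : Obs p L)) := by
  ext s hs
  rw [h.apply_eq_sum hs, Measure.finsetSum_apply]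
  refine Finset.sum_congr rfl fun ℓ _ => ?_
  rw [Measure.smul_apply, Measure.map_apply (by fun_prop) hs, smul_eq_mul]

/-- The law of a pair `(X, Y)` is that of `(μ_Y + S^{1/2} g, Y)` with an independent standard
Gaussian vector `g`. -/
lemma eq_map (h : IsLDALaw ν prior μ S) :
    ν = ((ν.map Prod.snd).prod (stdGaussian (EuclideanSpace ℝ (Fin p)))).map
      (fun a => ((μ a.1 + sqrtOp S a.2, a.1) : Obs p L)) := by
  have := h.isProbabilityMeasure
  have hmeas : Measurable fun a : Fin L × EuclideanSpace ℝ (Fin p) =>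
      ((μ a.1 + sqrtOp S a.2, a.1) : Obs p L) := by
    have : Measurable μ := measurable_of_countable μ
    fun_prop
  ext s hs
  rw [Measure.map_apply hmeas hs, Measure.prod_apply (hmeas hs), lintegral_fintype,
    h.apply_eq_sum hs]
  refine Finset.sum_congr rfl fun ℓ _ => ?_
  rw [multivariateGaussian_eq_map, Measure.map_apply (by fun_prop) (measurable_prodMk_right hs),
    Measure.map_apply measurable_snd (measurableSet_singleton ℓ), ← h.prob_label,
    ofReal_measureReal, mul_comm]
  rfl

lemma integral_eq (h : IsLDALaw ν prior μ S) {F : Type*} [NormedAddCommGroup F] [NormedSpace ℝ F]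
    [SecondCountableTopology F] [MeasurableSpace F] [BorelSpace F]
    {f : Obs p L → F} (hf : Measurable f)
    (hi : ∀ ℓ, Integrable (fun x => f (x, ℓ)) (multivariateGaussian (μ ℓ) S)) :
    Integrable f ν ∧
      ∫ z, f z ∂ν = ∑ ℓ, prior ℓ • ∫ x, f (x, ℓ) ∂(multivariateGaussian (μ ℓ) S) := by
  have hmap : ∀ ℓ : Fin L, AEMeasurable (fun x => ((x, ℓ) : Obs p L))
      (multivariateGaussian (μ ℓ) S) := fun ℓ => by fun_prop
  have hI : ∀ ℓ ∈ Finset.univ, Integrable f (ENNReal.ofReal (prior ℓ) •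
      (multivariateGaussian (μ ℓ) S).map (fun x => ((x, ℓ) : Obs p L))) := fun ℓ _ =>
    ((integrable_map_measure hf.aestronglyMeasurable (hmap ℓ)).2 (hi ℓ)).smul_measure
      ENNReal.ofReal_ne_top
  constructor
  · rw [h.eq_sum]
    exact integrable_finsetSum_measure.2 hI
  · conv_lhs => rw [h.eq_sum]
    rw [integral_finsetSum_measure hI]
    refine Finset.sum_congr rfl fun ℓ _ => ?_
    rw [integral_smul_measure, integral_map (hmap ℓ) hf.aestronglyMeasurable,
      ENNReal.toReal_ofReal (h.prior_pos ℓ).le]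

lemma sum_prior (h : IsLDALaw ν prior μ S) : ∑ ℓ, prior ℓ = 1 := by
  have := h.isProbabilityMeasure
  have := (h.integral_eq (f := fun _ => (1 : ℝ)) (by fun_prop) fun ℓ => integrable_const _).2
  simpa using this.symm

lemma memLp_eval_multivariateGaussian (m : EuclideanSpace ℝ (Fin p))
    (S : Matrix (Fin p) (Fin p) ℝ) (i : Fin p) :
    MemLp (fun x : EuclideanSpace ℝ (Fin p) => x i) 2 (multivariateGaussian m S) :=
  IsGaussian.memLp_dual (multivariateGaussian m S) (EuclideanSpace.proj i) 2 (by simp)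

lemma memLp_eval (h : IsLDALaw ν prior μ S) (i : Fin p) :
    MemLp (fun z : Obs p L => z.1 i) 2 ν := by
  rw [memLp_two_iff_integrable_sq (Measurable.aestronglyMeasurable (by fun_prop))]
  exact (h.integral_eq (by fun_prop) fun ℓ =>
    (memLp_eval_multivariateGaussian _ _ i).integrable_sq).1

lemma integral_eval (h : IsLDALaw ν prior μ S) (i : Fin p) : ∫ z, z.1 i ∂ν = 0 := by
  have hi : Integrable (fun z : Obs p L => z.1) ν :=
    (h.integral_eq measurable_fst fun ℓ => IsGaussian.integrable_id).1
  have := (EuclideanSpace.proj i : EuclideanSpace ℝ (Fin p) →L[ℝ] ℝ).integral_comp_comm hi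
  rw [h.centered, map_zero] at this
  exact this

/-- Since the mean vanishes, the covariance is the second moment; each class contributes its mean's
outer product plus `S`, and the weights of `S` sum to one. -/
lemma covX_apply (h : IsLDALaw ν prior μ S) (i j : Fin p) :
    covX ν i j = ∑ ℓ, prior ℓ * (μ ℓ i * μ ℓ j) + S i j := by
  have := h.isProbabilityMeasure
  have hcov : ∀ ℓ, ∫ x : EuclideanSpace ℝ (Fin p), x i * x j ∂(multivariateGaussian (μ ℓ) S) =
      μ ℓ i * μ ℓ j + S i j := by
    intro ℓ
    have h1 := covariance_eq_sub (memLp_eval_multivariateGaussian (μ ℓ) S i)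
      (memLp_eval_multivariateGaussian (μ ℓ) S j)
    rw [covariance_eval_multivariateGaussian h.posDef.posSemidef] at h1
    have h2 : ∀ k, ∫ x : EuclideanSpace ℝ (Fin p), x k ∂(multivariateGaussian (μ ℓ) S) =
        μ ℓ k := by
      intro k
      have := (EuclideanSpace.proj k : EuclideanSpace ℝ (Fin p) →L[ℝ] ℝ).integral_comp_comm
        (IsGaussian.integrable_id (μ := multivariateGaussian (μ ℓ) S))
      simpa using this
    rw [h2, h2] at h1
    simp only [Pi.mul_apply] at h1
    linarith
  rw [covX, Matrix.of_apply, covariance_eq_sub (h.memLp_eval i) (h.memLp_eval j), h.integral_eval,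
    zero_mul, sub_zero]
  simp only [Pi.mul_apply]
  rw [(h.integral_eq (f := fun z : Obs p L => z.1 i * z.1 j) (by fun_prop) fun ℓ =>
    (memLp_eval_multivariateGaussian _ _ i).integrable_mul
      (memLp_eval_multivariateGaussian _ _ j)).2]
  simp only [hcov, smul_eq_mul, mul_add, Finset.sum_add_distrib, ← Finset.sum_mul, h.sum_prior,
    one_mul]

lemma covXY_apply (h : IsLDALaw ν prior μ S) (i : Fin p) (k : Fin L) :
    covXY ν i k = prior k * μ k i := by
  have := h.isProbabilityMeasure
  have hone : Measurable fun z : Obs p L => oneHot z.2 k := by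
    have : Measurable fun y : Fin L => oneHot y k := measurable_of_countable _
    fun_prop
  have hb : MemLp (fun z : Obs p L => oneHot z.2 k) 2 ν := by
    refine MemLp.of_bound hone.aestronglyMeasurable 1 (ae_of_all _ fun z => ?_)
    unfold oneHot
    split_ifs <;> simp
  rw [covXY, Matrix.of_apply, covariance_eq_sub (h.memLp_eval i) hb, h.integral_eval,
    zero_mul, sub_zero]
  simp only [Pi.mul_apply]
  have hint : ∀ ℓ, Integrable (fun x : EuclideanSpace ℝ (Fin p) => x i)
      (multivariateGaussian (μ ℓ) S) := fun ℓ =>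
    (memLp_eval_multivariateGaussian _ _ i).integrable (by norm_num)
  rw [(h.integral_eq (f := fun z : Obs p L => z.1 i * oneHot z.2 k) (by fun_prop) fun ℓ =>
    (hint ℓ).mul_const (oneHot ℓ k)).2]
  rw [Finset.sum_eq_single k]
  · have := (EuclideanSpace.proj i : EuclideanSpace ℝ (Fin p) →L[ℝ] ℝ).integral_comp_comm
      (IsGaussian.integrable_id (μ := multivariateGaussian (μ k) S))
    simp [oneHot] at this ⊢
    exact Or.inl this
  · intro ℓ _ hℓ
    simp [oneHot, hℓ]
  · simp

end IsLDALaw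

/-- The quadratic form of the unconditional covariance matrix, in polarized form. -/
def popForm {p L : ℕ} (prior : Fin L → ℝ) (μ : Fin L → EuclideanSpace ℝ (Fin p))
    (S : Matrix (Fin p) (Fin p) ℝ) (e b : EuclideanSpace ℝ (Fin p)) : ℝ :=
  ∑ ℓ, prior ℓ * (inner ℝ e (μ ℓ) * inner ℝ b (μ ℓ)) + inner ℝ (sqrtOp S e) (sqrtOp S b)

namespace IsLDALaw

variable {p L : ℕ} {ν : Measure (Obs p L)} {prior : Fin L → ℝ}
  {μ : Fin L → EuclideanSpace ℝ (Fin p)} {S : Matrix (Fin p) (Fin p) ℝ}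

lemma dotProduct_covX_mulVec (h : IsLDALaw ν prior μ S) (e b : EuclideanSpace ℝ (Fin p)) :
    e.ofLp ⬝ᵥ (covX ν).mulVec b.ofLp = popForm prior μ S e b := by
  have hin : ∀ (x : EuclideanSpace ℝ (Fin p)) ℓ, inner ℝ x (μ ℓ) = ∑ i, x i * μ ℓ i := by
    intro x ℓ
    simp [PiLp.inner_apply, mul_comm]
  rw [popForm, inner_sqrtOp h.posDef.posSemidef]
  have hX : covX ν = (∑ ℓ, prior ℓ • Matrix.vecMulVec (μ ℓ).ofLp (μ ℓ).ofLp) + S := by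
    ext i j
    rw [h.covX_apply, Matrix.add_apply, Matrix.sum_apply]
    rfl
  rw [hX, Matrix.add_mulVec, dotProduct_add, Matrix.sum_mulVec, dotProduct_sum]
  congr 1
  refine Finset.sum_congr rfl fun ℓ _ => ?_
  rw [Matrix.smul_mulVec, Matrix.vecMulVec_mulVec, hin, hin, dotProduct_smul]
  simp only [dotProduct, Pi.smul_apply, MulOpposite.smul_eq_mul_unop, MulOpposite.unop_op,
    smul_eq_mul, ← mul_assoc, ← Finset.sum_mul]
  simp only [mul_comm, mul_assoc]

/-- The between-class part is nonnegative and `S` is positive definite. Hence the inverse in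
`regMatrix` is a genuine one and the normal equations hold. -/
lemma posDef_covX (h : IsLDALaw ν prior μ S) : (covX ν).PosDef := by
  refine Matrix.PosDef.of_dotProduct_mulVec_pos ?_ fun x hx => ?_
  · ext i j
    rw [Matrix.conjTranspose_apply, star_trivial, covX, Matrix.of_apply, Matrix.of_apply,
      covariance_comm]
  · have h1 := h.dotProduct_covX_mulVec (WithLp.toLp 2 x) (WithLp.toLp 2 x)
    have h2 := h.posDef.dotProduct_mulVec_pos hx
    simp only [star_trivial] at h2 ⊢
    rw [h1, popForm, inner_sqrtOp h.posDef.posSemidef]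
    refine add_pos_of_nonneg_of_pos (Finset.sum_nonneg fun ℓ _ => ?_) h2
    exact mul_nonneg (h.prior_pos ℓ).le (mul_self_nonneg _)

/-- The defining property of the regression matrix. -/
lemma popForm_regMatrix (h : IsLDALaw ν prior μ S) (e : EuclideanSpace ℝ (Fin p))
    (v : Fin L → ℝ) :
    popForm prior μ S e (WithLp.toLp 2 ((regMatrix ν).mulVec v)) =
      ∑ ℓ, prior ℓ * (inner ℝ e (μ ℓ) * v ℓ) := by
  rw [← h.dotProduct_covX_mulVec, regMatrix, Matrix.mulVec_mulVec, ← Matrix.mul_assoc,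
    Matrix.mul_nonsing_inv _ ((Matrix.isUnit_iff_isUnit_det _).1 h.posDef_covX.isUnit),
    Matrix.one_mul]
  simp only [dotProduct, Matrix.mulVec, h.covXY_apply, PiLp.inner_apply, Finset.mul_sum,
    Finset.sum_mul]
  rw [Finset.sum_comm]
  refine Finset.sum_congr rfl fun ℓ _ => Finset.sum_congr rfl fun i _ => ?_
  simp
  ring

end IsLDALaw

/-! ### Deterministic error analysis on a good sample -/

lemma frobNorm_sq {m n : ℕ} (Q : Matrix (Fin m) (Fin n) ℝ) :
    frobNorm Q ^ 2 = ∑ i, ∑ j, Q i j ^ 2 :=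
  Real.sq_sqrt (Finset.sum_nonneg fun _ _ => Finset.sum_nonneg fun _ _ => sq_nonneg _)

/-- Cauchy–Schwarz over the rows; this is where the factor `√p` of `ω₁` arises. -/
lemma rowNorm_le {m n : ℕ} (Q : Matrix (Fin m) (Fin n) ℝ) : rowNorm Q ≤ √m * frobNorm Q := by
  have h := Finset.sum_mul_sq_le_sq_mul_sq Finset.univ (fun _ : Fin m => (1 : ℝ))
    (fun i => √(∑ j, Q i j ^ 2))
  simp only [one_mul, one_pow, Finset.sum_const, Finset.card_univ, Fintype.card_fin, nsmul_eq_mul,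
    mul_one, Real.sq_sqrt (Finset.sum_nonneg fun _ _ => sq_nonneg (Q _ _))] at h
  rw [frobNorm, ← Real.sqrt_mul (Nat.cast_nonneg m)]
  exact Real.le_sqrt_of_sq_le h

/-- The least squares residual `⟨v, Y - Bᵀ X⟩`. -/
def residual {p L : ℕ} (B : Matrix (Fin p) (Fin L) ℝ) (v : Fin L → ℝ) (z : Obs p L) : ℝ :=
  v z.2 - inner ℝ (WithLp.toLp 2 (B.mulVec v)) z.1

/-- Samples whose Gram matrix dominates that of the population and whose noise has a projection
onto the column space of the features of squared operator norm at most `n * H`. -/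
def goodSamples {p L : ℕ} (n : ℕ) (prior : Fin L → ℝ) (μ : Fin L → EuclideanSpace ℝ (Fin p))
    (S : Matrix (Fin p) (Fin p) ℝ) (B : Matrix (Fin p) (Fin L) ℝ) (H : ℝ) :
    Set (Fin n → Obs p L) :=
  {d | ∀ e : EuclideanSpace ℝ (Fin p),
    n * popForm prior μ S e e ≤ 2 * ∑ i, inner ℝ e (d i).1 ^ 2 ∧
    ∀ v : Fin L → ℝ, (∑ i, inner ℝ e (d i).1 * residual B v (d i)) ^ 2 ≤
      n * H * (∑ ℓ, v ℓ ^ 2) * ∑ i, inner ℝ e (d i).1 ^ 2}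

section Deterministic

variable {n p L : ℕ}

/-- Uncountably many directions are involved, but each condition is closed in the sample because the
labels are discrete, so the intersection is closed. -/
lemma measurableSet_goodSamples (prior : Fin L → ℝ) (μ : Fin L → EuclideanSpace ℝ (Fin p))
    (S : Matrix (Fin p) (Fin p) ℝ) (B : Matrix (Fin p) (Fin L) ℝ) (H : ℝ) :
    MeasurableSet (goodSamples n prior μ S B H) := by
  refine IsClosed.measurableSet ?_
  have hres : ∀ v : Fin L → ℝ, Continuous (residual B v) := by
    intro v
    have : Continuous v := continuous_of_discreteTopology
    unfold residual
    fun_prop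
  have e : goodSamples n prior μ S B H = ⋂ e : EuclideanSpace ℝ (Fin p),
      {d | n * popForm prior μ S e e ≤ 2 * ∑ i, inner ℝ e (d i).1 ^ 2} ∩
      ⋂ v : Fin L → ℝ, {d | (∑ i, inner ℝ e (d i).1 * residual B v (d i)) ^ 2 ≤
        n * H * (∑ ℓ, v ℓ ^ 2) * ∑ i, inner ℝ e (d i).1 ^ 2} := by
    ext d
    simp [goodSamples]
  rw [e]
  refine isClosed_iInter fun e => IsClosed.inter (isClosed_le (by fun_prop) (by fun_prop))
    (isClosed_iInter fun v => isClosed_le ?_ (by fun_prop))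
  have := hres v
  fun_prop

/-- The `i`-th entry of `X e`. -/
lemma featureMatrix_mulVec (d : Fin n → Obs p L) (e : EuclideanSpace ℝ (Fin p)) (i : Fin n) :
    (featureMatrix d).mulVec e.ofLp i = inner ℝ e (d i).1 := by
  simp [featureMatrix, Matrix.mulVec, dotProduct, PiLp.inner_apply, mul_comm]

lemma residual_eq (d : Fin n → Obs p L) (B : Matrix (Fin p) (Fin L) ℝ) (v : Fin L → ℝ)
    (i : Fin n) :
    (responseMatrix d - featureMatrix d * B).mulVec v i = residual B v (d i) := by
  rw [Matrix.sub_mulVec, ← Matrix.mulVec_mulVec, Pi.sub_apply]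
  have := featureMatrix_mulVec d (WithLp.toLp 2 (B.mulVec v)) i
  simp only at this
  rw [this, residual]
  congr 1
  simp [responseMatrix, Matrix.mulVec, dotProduct, oneHot]

/-- The inner product of the noise with a matrix of fits `X D` is controlled through the rank. -/
lemma noise_inner_sq_le {d : Fin n → Obs p L} {prior : Fin L → ℝ}
    {μ : Fin L → EuclideanSpace ℝ (Fin p)} {S : Matrix (Fin p) (Fin p) ℝ}
    {B : Matrix (Fin p) (Fin L) ℝ} {H : ℝ} (hd : d ∈ goodSamples n prior μ S B H)
    (D : Matrix (Fin p) (Fin L) ℝ) :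
    (∑ i, ∑ ℓ, (responseMatrix d - featureMatrix d * B) i ℓ * (featureMatrix d * D) i ℓ) ^ 2 ≤
      n * H * D.rank * ∑ i, ∑ ℓ, (featureMatrix d * D) i ℓ ^ 2 := by
  set W := responseMatrix d - featureMatrix d * B with hW
  set G := featureMatrix d * D with hG
  -- An orthonormal basis `f_j` of the column space of `G` gives `G = ∑ f_j a_jᵀ` with at most `rank
  -- D` terms, and `⟨W, G⟩ = ∑ f_jᵀ W a_j`.
  let col : Fin L → EuclideanSpace ℝ (Fin n) := fun ℓ => WithLp.toLp 2 (G.col ℓ)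
  let V : Submodule ℝ (EuclideanSpace ℝ (Fin n)) := Submodule.span ℝ (Set.range col)
  let f := stdOrthonormalBasis ℝ V
  let k := Module.finrank ℝ V
  let a : Fin k → Fin L → ℝ := fun j ℓ => inner ℝ (f j : EuclideanSpace ℝ (Fin n)) (col ℓ)
  have hrank : k ≤ D.rank := by
    refine le_trans (le_of_eq ?_) (Matrix.rank_mul_le_right (featureMatrix d) D)
    have hV : V = (Submodule.span ℝ (Set.range G.col)).map
        (WithLp.linearEquiv 2 ℝ (Fin n → ℝ)).symm.toLinearMap := by
      rw [Submodule.map_span, ← Set.range_comp]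
      rfl
    rw [← hG, Matrix.rank_eq_finrank_span_cols, ← LinearEquiv.finrank_map_eq
      (WithLp.linearEquiv 2 ℝ (Fin n → ℝ)).symm, ← hV]
  have hmem : ∀ ℓ, col ℓ ∈ V := fun ℓ => Submodule.subset_span ⟨ℓ, rfl⟩
  have hexp : ∀ ℓ, col ℓ = ∑ j, a j ℓ • (f j : EuclideanSpace ℝ (Fin n)) := by
    intro ℓ
    have := f.sum_repr' ⟨col ℓ, hmem ℓ⟩
    have := congrArg (Subtype.val) this
    simpa [a] using this.symm
  have hGe : ∀ i ℓ, G i ℓ = ∑ j, a j ℓ * (f j : EuclideanSpace ℝ (Fin n)) i := by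
    intro i ℓ
    have := congrArg (fun x : EuclideanSpace ℝ (Fin n) => x i) (hexp ℓ)
    simpa [col] using this
  have hnorm : ∑ i, ∑ ℓ, G i ℓ ^ 2 = ∑ j, ∑ ℓ, a j ℓ ^ 2 := by
    rw [Finset.sum_comm]
    refine Eq.trans ?_ Finset.sum_comm
    refine Finset.sum_congr rfl fun ℓ _ => ?_
    have := f.sum_sq_norm_inner_right ⟨col ℓ, hmem ℓ⟩
    have h2 : ‖(⟨col ℓ, hmem ℓ⟩ : V)‖ ^ 2 = ∑ i, G i ℓ ^ 2 := by
      rw [Submodule.coe_norm, EuclideanSpace.real_norm_sq_eq]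
      rfl
    rw [← h2, ← this]
    exact Finset.sum_congr rfl fun j _ => by simp [a]
  -- Each `f_j` lies in the range of `X`, so the noise condition of `goodSamples` applies to it.
  have hrange : ∀ j, ∃ e : EuclideanSpace ℝ (Fin p),
      ∀ i, (f j : EuclideanSpace ℝ (Fin n)) i = inner ℝ e (d i).1 := by
    intro j
    suffices h : ∀ x ∈ V, ∃ e : EuclideanSpace ℝ (Fin p), ∀ i, x i = inner ℝ e (d i).1 from
      h _ (f j).2
    intro x hx
    induction hx using Submodule.span_induction with
    | mem x hx =>
      obtain ⟨ℓ, rfl⟩ := hx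
      refine ⟨WithLp.toLp 2 (D.col ℓ), fun i => ?_⟩
      rw [← featureMatrix_mulVec]
      rfl
    | zero => exact ⟨0, by simp⟩
    | add x y _ _ hx hy =>
      obtain ⟨e, he⟩ := hx
      obtain ⟨e', he'⟩ := hy
      exact ⟨e + e', fun i => by simp [inner_add_left, he, he']⟩
    | smul c x _ hx =>
      obtain ⟨e, he⟩ := hx
      exact ⟨c • e, fun i => by simp [real_inner_smul_left, he]⟩
  choose e he using hrange
  have hterm : ∀ j, (∑ i, (f j : EuclideanSpace ℝ (Fin n)) i * residual B (a j) (d i)) ^ 2 ≤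
      n * H * ∑ ℓ, a j ℓ ^ 2 := by
    intro j
    have h1 := (hd (e j)).2 (a j)
    simp only [← he] at h1
    have h2 : ∑ i, (f j : EuclideanSpace ℝ (Fin n)) i ^ 2 = 1 := by
      rw [← EuclideanSpace.real_norm_sq_eq, ← Submodule.coe_norm, f.orthonormal.1 j, one_pow]
    rwa [h2, mul_one] at h1
  have hinner : ∑ i, ∑ ℓ, W i ℓ * G i ℓ =
      ∑ j, ∑ i, (f j : EuclideanSpace ℝ (Fin n)) i * residual B (a j) (d i) := by
    refine Eq.trans ?_ Finset.sum_comm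
    refine Finset.sum_congr rfl fun i _ => ?_
    simp only [← residual_eq, ← hW, Matrix.mulVec, dotProduct, hGe, Finset.mul_sum]
    rw [Finset.sum_comm]
    exact Finset.sum_congr rfl fun j _ => Finset.sum_congr rfl fun ℓ _ => by ring
  rw [hinner, hnorm]
  -- Cauchy–Schwarz over the basis produces the rank factor.
  calc _ ≤ (k : ℝ) *
        ∑ j, (∑ i, (f j : EuclideanSpace ℝ (Fin n)) i * residual B (a j) (d i)) ^ 2 := by
        have := sq_sum_le_card_mul_sum_sq (s := (Finset.univ : Finset (Fin k)))
          (f := fun j => ∑ i, (f j : EuclideanSpace ℝ (Fin n)) i * residual B (a j) (d i))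
        simpa using this
    _ ≤ D.rank * ∑ j, n * H * ∑ ℓ, a j ℓ ^ 2 := by
        have : (k : ℝ) ≤ D.rank := by exact_mod_cast hrank
        gcongr with j
        exact hterm j
    _ = _ := by rw [← Finset.mul_sum]; ring

lemma rank_sub_le (A B : Matrix (Fin p) (Fin L) ℝ) : (A - B).rank ≤ B.rank + A.rank := by
  have hle : LinearMap.range (A - B).mulVecLin ≤
      LinearMap.range B.mulVecLin ⊔ LinearMap.range A.mulVecLin := by
    rintro _ ⟨v, rfl⟩
    rw [Matrix.mulVecLin_apply, Matrix.sub_mulVec]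
    exact Submodule.sub_mem _ (Submodule.mem_sup_right ⟨v, rfl⟩)
      (Submodule.mem_sup_left ⟨v, rfl⟩)
  exact (Submodule.finrank_mono hle).trans (Submodule.finrank_add_le_finrank_add_finrank _ _)

/-- The basic inequality of rank-penalized least squares. -/
lemma sum_sq_fit_le {d : Fin n → Obs p L} {prior : Fin L → ℝ}
    {μ : Fin L → EuclideanSpace ℝ (Fin p)} {S : Matrix (Fin p) (Fin p) ℝ}
    {B A : Matrix (Fin p) (Fin L) ℝ} {H lam : ℝ} (hn : 1 ≤ n)
    (hd : d ∈ goodSamples n prior μ S B H) (hH : 0 ≤ H) (hlam : 2 * H ≤ lam)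
    (hA : IsRankEstimate lam d A) :
    ∑ i, ∑ ℓ, (featureMatrix d * (A - B)) i ℓ ^ 2 ≤ 4 * n * (lam * B.rank) := by
  have hn' : (0 : ℝ) < n := by exact_mod_cast hn
  set W := responseMatrix d - featureMatrix d * B with hW
  set G := featureMatrix d * (A - B) with hG
  have hmin := hA B
  have hWG : responseMatrix d - featureMatrix d * A = W - G := by
    rw [hW, hG, Matrix.mul_sub]; abel
  unfold rankCriterion at hmin
  rw [hWG, frobNorm_sq, ← hW, frobNorm_sq] at hmin
  have hexp : ∑ i, ∑ ℓ, (W - G) i ℓ ^ 2 = ∑ i, ∑ ℓ, W i ℓ ^ 2 - 2 * ∑ i, ∑ ℓ, W i ℓ * G i ℓ +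
      ∑ i, ∑ ℓ, G i ℓ ^ 2 := by
    simp only [Finset.mul_sum, ← Finset.sum_sub_distrib, ← Finset.sum_add_distrib]
    refine Finset.sum_congr rfl fun i _ => Finset.sum_congr rfl fun ℓ _ => ?_
    rw [Matrix.sub_apply]; ring
  have hcs := noise_inner_sq_le hd (A - B)
  rw [← hW, ← hG] at hcs
  have hr : ((A - B).rank : ℝ) ≤ B.rank + A.rank := by exact_mod_cast rank_sub_le A B
  have hF : 0 ≤ ∑ i, ∑ ℓ, G i ℓ ^ 2 :=
    Finset.sum_nonneg fun _ _ => Finset.sum_nonneg fun _ _ => sq_nonneg _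
  rw [hexp] at hmin
  set F := ∑ i, ∑ ℓ, G i ℓ ^ 2
  set I := ∑ i, ∑ ℓ, W i ℓ * G i ℓ
  set R := ∑ i, ∑ ℓ, W i ℓ ^ 2
  have h1 : F ≤ 2 * I + n * (lam * (B.rank - A.rank)) := by
    have := mul_le_mul_of_nonneg_left hmin hn'.le
    have e1 : (n : ℝ) * (1 / n * (R - 2 * I + F) + lam * A.rank) =
        R - 2 * I + F + n * (lam * A.rank) := by field_simp
    have e2 : (n : ℝ) * (1 / n * R + lam * B.rank) = R + n * (lam * B.rank) := by field_simp
    rw [e1, e2] at this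
    linarith
  -- From `I² ≤ M F` by the arithmetic–geometric mean inequality, `4MF ≤ (F/2 + 2M)²`.
  have h2 : 2 * I ≤ F / 2 + 2 * (n * H * (B.rank + A.rank)) := by
    have h3 : I ^ 2 ≤ n * H * (B.rank + A.rank) * F := hcs.trans (by gcongr)
    set M := n * H * ((B.rank : ℝ) + A.rank)
    have hM : 0 ≤ M := by positivity
    have : (2 * I) ^ 2 ≤ (F / 2 + 2 * M) ^ 2 := by nlinarith [sq_nonneg (F / 2 - 2 * M)]
    exact (abs_le_of_sq_le_sq' this (by positivity)).2
  -- Because `2H ≤ λ`, the noise costs `nλ(rank B + rank A)`. Adding the penalty difference cancels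
  -- `rank A`.
  have h4 : 2 * (n * H * ((B.rank : ℝ) + A.rank)) ≤ n * lam * (B.rank + A.rank) := by
    have : (n : ℝ) * (2 * H) * (B.rank + A.rank) ≤ n * lam * (B.rank + A.rank) := by gcongr
    linarith
  linarith

end Deterministic

/-- A lower bound on the eigenvalues is a lower bound on the quadratic form. -/
lemma mul_norm_sq_le_norm_sqrtOp_sq {p : ℕ} {c : ℝ} {S : Matrix (Fin p) (Fin p) ℝ}
    (hS : S.PosSemidef) (hc : ∃ hS : S.IsHermitian, ∀ j, c < hS.eigenvalues j)
    (x : EuclideanSpace ℝ (Fin p)) : c * ‖x‖ ^ 2 ≤ ‖sqrtOp S x‖ ^ 2 := by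
  obtain ⟨hH, hlt⟩ := hc
  rw [← real_inner_self_eq_norm_sq (sqrtOp S x), inner_sqrtOp hS, ← Matrix.inner_toEuclideanCLM,
    ← hH.eigenvectorBasis.sum_inner_mul_inner x, ← hH.eigenvectorBasis.sum_sq_inner_right,
    Finset.mul_sum]
  refine Finset.sum_le_sum fun j _ => ?_
  have : inner ℝ (hH.eigenvectorBasis j) (Matrix.toEuclideanCLM (𝕜 := ℝ) S x) =
      hH.eigenvalues j * inner ℝ (hH.eigenvectorBasis j) x := by
    rw [Matrix.inner_toEuclideanCLM, Matrix.dotProduct_mulVec, ← Matrix.mulVec_transpose]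
    have hT : S.transpose = S := by
      have := hH.eq
      rwa [Matrix.conjTranspose_eq_transpose_of_trivial] at this
    rw [hT, hH.mulVec_eigenvectorBasis, smul_dotProduct]
    simp [PiLp.inner_apply, dotProduct, mul_comm]
  rw [this, real_inner_comm]
  nlinarith [hlt j, sq_nonneg (inner ℝ (hH.eigenvectorBasis j) x)]

/-- Test the quadratic form on a coordinate unit vector, which needs `p > 0`. The bound keeps the
factor `√(‖Σ_W‖_op (1 + Δ))` of the penalty away from zero. -/
lemma le_opNorm_of_lt_eigenvalues {p : ℕ} (hp : 0 < p) {c : ℝ} {S : Matrix (Fin p) (Fin p) ℝ}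
    (hS : S.PosSemidef) (hc : ∃ hS : S.IsHermitian, ∀ j, c < hS.eigenvalues j) :
    c ≤ opNorm S := by
  let x : EuclideanSpace ℝ (Fin p) := EuclideanSpace.single ⟨0, hp⟩ 1
  have hx : ‖x‖ = 1 := by simp [x]
  have h1 := mul_norm_sq_le_norm_sqrtOp_sq hS hc x
  rw [← real_inner_self_eq_norm_sq (sqrtOp S x), inner_sqrtOp hS, ← Matrix.inner_toEuclideanCLM,
    hx, one_pow, mul_one] at h1
  refine h1.trans ((real_inner_le_norm _ _).trans ?_)
  have := (Matrix.toEuclideanCLM (𝕜 := ℝ) S).le_opNorm x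
  rw [hx, mul_one] at this
  rwa [hx, one_mul]

/-- The error bounds hold for each rank-penalized estimate on a good sample. -/
lemma errorBounds_of_mem_goodSamples {n p L : ℕ} {d : Fin n → Obs p L} {prior : Fin L → ℝ}
    {μ : Fin L → EuclideanSpace ℝ (Fin p)} {S : Matrix (Fin p) (Fin p) ℝ}
    {B A : Matrix (Fin p) (Fin L) ℝ} {H lam c : ℝ} (hn : 1 ≤ n) (hprior : ∀ ℓ, 0 ≤ prior ℓ)
    (hS : S.PosSemidef) (hc0 : 0 < c) (hc : ∃ hS : S.IsHermitian, ∀ j, c < hS.eigenvalues j)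
    (hd : d ∈ goodSamples n prior μ S B H) (hH : 0 ≤ H) (hlam : 2 * H ≤ lam)
    (hA : IsRankEstimate lam d A) :
    ErrorBounds d S A B (3 / √c * √(lam * B.rank * p)) (3 * √(lam * B.rank)) := by
  have hn' : (0 : ℝ) < n := by exact_mod_cast hn
  have hfit := sum_sq_fit_le hn hd hH hlam hA
  have hl : 0 ≤ lam * B.rank := mul_nonneg (by linarith) (Nat.cast_nonneg _)
  set D := A - B
  let col : Fin L → EuclideanSpace ℝ (Fin p) := fun ℓ => WithLp.toLp 2 (D.col ℓ)
  have hfit' : ∑ i, ∑ ℓ, (featureMatrix d * D) i ℓ ^ 2 =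
      ∑ ℓ, ∑ i, inner ℝ (col ℓ) (d i).1 ^ 2 := by
    rw [Finset.sum_comm]
    refine Finset.sum_congr rfl fun ℓ _ => Finset.sum_congr rfl fun i _ => ?_
    rw [← featureMatrix_mulVec]
    rfl
  have hsqrt : frobNorm (sqrtMat S * D) ^ 2 = ∑ ℓ, ‖sqrtOp S (col ℓ)‖ ^ 2 := by
    rw [frobNorm_sq, Finset.sum_comm]
    refine Finset.sum_congr rfl fun ℓ _ => ?_
    rw [EuclideanSpace.real_norm_sq_eq]
    refine Finset.sum_congr rfl fun i _ => ?_
    rw [sqrtOp, Matrix.ofLp_toEuclideanCLM]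
    rfl
  have h1 : frobNorm (sqrtMat S * D) ^ 2 ≤ 8 * (lam * B.rank) := by
    have : n * ∑ ℓ, ‖sqrtOp S (col ℓ)‖ ^ 2 ≤ 2 * (4 * n * (lam * B.rank)) := by
      refine le_trans ?_ (mul_le_mul_of_nonneg_left hfit zero_le_two)
      rw [hfit', Finset.mul_sum, Finset.mul_sum]
      refine Finset.sum_le_sum fun ℓ _ => le_trans ?_ (hd (col ℓ)).1
      gcongr
      rw [popForm, real_inner_self_eq_norm_sq]
      exact le_add_of_nonneg_left
        (Finset.sum_nonneg fun k _ => mul_nonneg (hprior k) (mul_self_nonneg _))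
    rw [hsqrt]
    refine le_of_mul_le_mul_left ?_ hn'
    linarith
  have h2 : c * frobNorm D ^ 2 ≤ 8 * (lam * B.rank) := by
    refine le_trans ?_ h1
    rw [hsqrt, frobNorm_sq, Finset.sum_comm, Finset.mul_sum]
    refine Finset.sum_le_sum fun ℓ _ => le_trans (le_of_eq ?_)
      (mul_norm_sq_le_norm_sqrtOp_sq hS hc (col ℓ))
    rw [EuclideanSpace.real_norm_sq_eq]
    rfl
  -- The constant 3 covers both `√4` from the empirical fit and `√8` from Gram domination.
  have hsq : (3 * √(lam * B.rank)) ^ 2 = 9 * (lam * B.rank) := by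
    rw [mul_pow, Real.sq_sqrt hl]; norm_num
  refine ⟨max_le ?_ ?_, ?_⟩
  · refine (abs_le_of_sq_le_sq' ?_ (by positivity)).2
    rw [div_pow, Real.sq_sqrt hn'.le, frobNorm_sq, hsq, div_le_iff₀ hn']
    nlinarith
  · refine (abs_le_of_sq_le_sq' ?_ (by positivity)).2
    rw [hsq]
    linarith
  · refine (rowNorm_le D).trans ?_
    have h3 : frobNorm D ≤ 3 / √c * √(lam * B.rank) := by
      refine (abs_le_of_sq_le_sq' ?_ (by positivity)).2
      rw [mul_pow, div_pow, Real.sq_sqrt hc0.le, Real.sq_sqrt hl, div_mul_eq_mul_div,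
        le_div_iff₀ hc0]
      linarith
    rw [Real.sqrt_mul hl]
    calc _ ≤ √p * (3 / √c * √(lam * B.rank)) := by gcongr
      _ = _ := by ring

/-! ### From concentration of labels and Gaussian vectors to good samples -/

section Realization

variable {n p L : ℕ}

lemma sum_comp_eq_sum_count (y : Fin n → Fin L) (u : Fin L → ℝ) :
    ∑ i, u (y i) = ∑ ℓ, (∑ i, if y i = ℓ then (1 : ℝ) else 0) * u ℓ := by
  simp only [Finset.sum_mul]
  rw [Finset.sum_comm]
  simp

/-- Empirical label averages of products are relatively close to their expectations. -/
lemma abs_sum_label_sub_le {y : Fin n → Fin L} {prior : Fin L → ℝ} (hprior : ∀ ℓ, 0 < prior ℓ)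
    {t : ℝ} (ht : 0 ≤ t)
    (hy : ∀ ℓ, |∑ i, (if y i = ℓ then (1 : ℝ) else 0) - n * prior ℓ| ≤ t * (n * prior ℓ))
    (a c : Fin L → ℝ) :
    |∑ i, a (y i) * c (y i) - n * ∑ ℓ, prior ℓ * (a ℓ * c ℓ)| ≤
      n * t * (√(∑ ℓ, prior ℓ * a ℓ ^ 2) * √(∑ ℓ, prior ℓ * c ℓ ^ 2)) := by
  rw [sum_comp_eq_sum_count y fun ℓ => a ℓ * c ℓ, Finset.mul_sum, ← Finset.sum_sub_distrib]
  have hcs : ∑ ℓ, prior ℓ * (|a ℓ| * |c ℓ|) ≤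
      √(∑ ℓ, prior ℓ * a ℓ ^ 2) * √(∑ ℓ, prior ℓ * c ℓ ^ 2) := by
    have := Real.sum_mul_le_sqrt_mul_sqrt Finset.univ (fun ℓ => √(prior ℓ) * |a ℓ|)
      (fun ℓ => √(prior ℓ) * |c ℓ|)
    simp only [mul_pow, Real.sq_sqrt (hprior _).le, sq_abs] at this
    refine le_trans (le_of_eq (Finset.sum_congr rfl fun ℓ _ => ?_)) this
    have := Real.mul_self_sqrt (hprior ℓ).le
    linear_combination (-(|a ℓ| * |c ℓ|)) * this
  calc _ ≤ ∑ ℓ, |(∑ i, if y i = ℓ then (1 : ℝ) else 0) * (a ℓ * c ℓ) -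
        n * (prior ℓ * (a ℓ * c ℓ))| := Finset.abs_sum_le_sum_abs _ _
    _ ≤ ∑ ℓ, n * t * (prior ℓ * (|a ℓ| * |c ℓ|)) := by
      refine Finset.sum_le_sum fun ℓ _ => ?_
      rw [← mul_assoc (n : ℝ), ← sub_mul, abs_mul, abs_mul]
      calc _ ≤ t * (n * prior ℓ) * (|a ℓ| * |c ℓ|) := by
            gcongr
            exact hy ℓ
        _ = _ := by ring
    _ ≤ _ := by
      rw [← Finset.mul_sum]
      gcongr

/-- The weights `w_{y_i} / √π_{y_i}`. -/
def labelWeight (prior : Fin L → ℝ) (y : Fin n → Fin L) :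
    EuclideanSpace ℝ (Fin L) →ₗ[ℝ] Fin n → ℝ where
  toFun w i := w (y i) / √(prior (y i))
  map_add' w w' := by ext i; simp [add_div]
  map_smul' c w := by ext i; simp [mul_div_assoc]

/-- Counts are at most twice their expectation, so dividing by `√π_ℓ` normalizes every class
whatever its probability. This is the hypothesis of `stdGaussian_pi_bilinear_tail`. -/
lemma sum_labelWeight_sq_le {y : Fin n → Fin L} {prior : Fin L → ℝ} (hprior : ∀ ℓ, 0 < prior ℓ)
    {t : ℝ} (ht : t ≤ 1)
    (hy : ∀ ℓ, |∑ i, (if y i = ℓ then (1 : ℝ) else 0) - n * prior ℓ| ≤ t * (n * prior ℓ))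
    (w : EuclideanSpace ℝ (Fin L)) :
    ∑ i, labelWeight prior y w i ^ 2 ≤ 2 * n * ‖w‖ ^ 2 := by
  have h1 : ∑ i, labelWeight prior y w i ^ 2 =
      ∑ ℓ, (∑ i, if y i = ℓ then (1 : ℝ) else 0) * (w ℓ ^ 2 / prior ℓ) := by
    rw [← sum_comp_eq_sum_count y fun ℓ => w ℓ ^ 2 / prior ℓ]
    refine Finset.sum_congr rfl fun i _ => ?_
    simp only [labelWeight, LinearMap.coe_mk, AddHom.coe_mk, div_pow, Real.sq_sqrt (hprior _).le]
  rw [h1, EuclideanSpace.real_norm_sq_eq, Finset.mul_sum]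
  refine Finset.sum_le_sum fun ℓ _ => ?_
  have h2 : ∑ i, (if y i = ℓ then (1 : ℝ) else 0) ≤ 2 * n * prior ℓ := by
    have h3 := (abs_le.1 (hy ℓ)).2
    have h4 : 0 ≤ n * prior ℓ := mul_nonneg (Nat.cast_nonneg n) (hprior ℓ).le
    nlinarith
  have hp := hprior ℓ
  calc _ ≤ 2 * n * prior ℓ * (w ℓ ^ 2 / prior ℓ) := by gcongr
    _ = _ := by field_simp

/-- Substituting `w_ℓ = √π_ℓ c_ℓ` undoes the normalization and yields the `π`-weighted norm of `c`.
-/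
lemma abs_sum_inner_label_le {y : Fin n → Fin L} {g : Fin n → EuclideanSpace ℝ (Fin p)}
    {prior : Fin L → ℝ} (hprior : ∀ ℓ, 0 < prior ℓ) {t : ℝ}
    (hg : ∀ (h : EuclideanSpace ℝ (Fin p)) (w : EuclideanSpace ℝ (Fin L)),
      |∑ i, inner ℝ h (g i) * labelWeight prior y w i| ≤ n * t * ‖h‖ * ‖w‖)
    (h : EuclideanSpace ℝ (Fin p)) (c : Fin L → ℝ) :
    |∑ i, inner ℝ h (g i) * c (y i)| ≤ n * t * (‖h‖ * √(∑ ℓ, prior ℓ * c ℓ ^ 2)) := by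
  have := hg h (WithLp.toLp 2 fun ℓ => √(prior ℓ) * c ℓ)
  have e : ‖(WithLp.toLp 2 fun ℓ => √(prior ℓ) * c ℓ : EuclideanSpace ℝ (Fin L))‖ =
      √(∑ ℓ, prior ℓ * c ℓ ^ 2) := by
    rw [EuclideanSpace.norm_eq]
    simp only [Real.norm_eq_abs, sq_abs, mul_pow, Real.sq_sqrt (hprior _).le]
  rw [e] at this
  refine le_trans (le_of_eq ?_) (this.trans (le_of_eq (mul_assoc _ _ _)))
  congr 1
  refine Finset.sum_congr rfl fun i _ => ?_
  have : √(prior (y i)) ≠ 0 := (Real.sqrt_pos.2 (hprior _)).ne'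
  simp only [labelWeight, LinearMap.coe_mk, AddHom.coe_mk]
  field_simp

lemma popForm_self {prior : Fin L → ℝ} {μ : Fin L → EuclideanSpace ℝ (Fin p)}
    {S : Matrix (Fin p) (Fin p) ℝ} (e : EuclideanSpace ℝ (Fin p)) :
    popForm prior μ S e e = ∑ ℓ, prior ℓ * inner ℝ e (μ ℓ) ^ 2 + ‖sqrtOp S e‖ ^ 2 := by
  rw [popForm, real_inner_self_eq_norm_sq]
  simp only [sq]

/-- The sample of features and labels built from labels and Gaussian vectors. -/
def sampleOf (μ : Fin L → EuclideanSpace ℝ (Fin p)) (S : Matrix (Fin p) (Fin p) ℝ)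
    (y : Fin n → Fin L) (g : Fin n → EuclideanSpace ℝ (Fin p)) : Fin n → Obs p L :=
  fun i => (μ (y i) + sqrtOp S (g i), y i)

variable {prior : Fin L → ℝ} {μ : Fin L → EuclideanSpace ℝ (Fin p)}
  {S : Matrix (Fin p) (Fin p) ℝ} {y : Fin n → Fin L} {g : Fin n → EuclideanSpace ℝ (Fin p)}
  {t : ℝ}

open scoped MatrixOrder in
lemma inner_sqrtOp_right (x z : EuclideanSpace ℝ (Fin p)) :
    inner ℝ x (sqrtOp S z) = inner ℝ (sqrtOp S x) z := by
  have hsa : IsSelfAdjoint (sqrtOp S) := (CFC.sqrt_nonneg S).isSelfAdjoint.map _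
  nth_rewrite 2 [← hsa.adjoint_eq]
  rw [ContinuousLinearMap.adjoint_inner_left]

lemma inner_sampleOf (e : EuclideanSpace ℝ (Fin p)) (i : Fin n) :
    inner ℝ e (sampleOf μ S y g i).1 = inner ℝ e (μ (y i)) + inner ℝ (sqrtOp S e) (g i) := by
  rw [sampleOf, inner_add_right, inner_sqrtOp_right]

/-- The deviation of the empirical second moments from the population ones. -/
lemma abs_gram_sub_le (hprior : ∀ ℓ, 0 < prior ℓ) (ht : 0 ≤ t)
    (hy : ∀ ℓ, |∑ i, (if y i = ℓ then (1 : ℝ) else 0) - n * prior ℓ| ≤ t * (n * prior ℓ))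
    (hcov : ∀ h h' : EuclideanSpace ℝ (Fin p),
      |∑ i, inner ℝ h (g i) * inner ℝ h' (g i) - n * inner ℝ h h'| ≤ n * t * ‖h‖ * ‖h'‖)
    (hg : ∀ (h : EuclideanSpace ℝ (Fin p)) (w : EuclideanSpace ℝ (Fin L)),
      |∑ i, inner ℝ h (g i) * labelWeight prior y w i| ≤ n * t * ‖h‖ * ‖w‖)
    (e b : EuclideanSpace ℝ (Fin p)) :
    |∑ i, inner ℝ e (sampleOf μ S y g i).1 * inner ℝ b (sampleOf μ S y g i).1 -
      n * popForm prior μ S e b| ≤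
      4 * (n * t * (√(popForm prior μ S e e) * √(popForm prior μ S b b))) := by
  have hnn : ∀ x : EuclideanSpace ℝ (Fin p), 0 ≤ ∑ ℓ, prior ℓ * inner ℝ x (μ ℓ) ^ 2 := fun x =>
    Finset.sum_nonneg fun ℓ _ => mul_nonneg (hprior ℓ).le (sq_nonneg _)
  have hbetween : ∀ x : EuclideanSpace ℝ (Fin p),
      √(∑ ℓ, prior ℓ * inner ℝ x (μ ℓ) ^ 2) ≤ √(popForm prior μ S x x) := by
    intro x
    rw [popForm_self]
    exact Real.sqrt_le_sqrt (le_add_of_nonneg_right (sq_nonneg _))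
  have hwithin : ∀ x : EuclideanSpace ℝ (Fin p), ‖sqrtOp S x‖ ≤ √(popForm prior μ S x x) := by
    intro x
    rw [popForm_self]
    exact Real.le_sqrt_of_sq_le (le_add_of_nonneg_left (hnn x))
  have hnt : 0 ≤ n * t := by positivity
  have h1 := abs_sum_label_sub_le hprior ht hy (fun ℓ => inner ℝ e (μ ℓ))
    (fun ℓ => inner ℝ b (μ ℓ))
  have h2 := abs_sum_inner_label_le hprior hg (sqrtOp S e) (fun ℓ => inner ℝ b (μ ℓ))
  have h3 := abs_sum_inner_label_le hprior hg (sqrtOp S b) (fun ℓ => inner ℝ e (μ ℓ))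
  have h4 := hcov (sqrtOp S e) (sqrtOp S b)
  have k1 := mul_le_mul_of_nonneg_left (mul_le_mul (hbetween e) (hbetween b)
    (Real.sqrt_nonneg _) (Real.sqrt_nonneg _)) hnt
  have k2 := mul_le_mul_of_nonneg_left (mul_le_mul (hwithin e) (hbetween b)
    (Real.sqrt_nonneg _) (Real.sqrt_nonneg _)) hnt
  have k3 := mul_le_mul_of_nonneg_left (mul_le_mul (hwithin b) (hbetween e)
    (Real.sqrt_nonneg _) (Real.sqrt_nonneg _)) hnt
  have k4 := mul_le_mul_of_nonneg_left (mul_le_mul (hwithin e) (hwithin b)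
    (norm_nonneg _) (Real.sqrt_nonneg _)) hnt
  -- Expanding `μ_y + S^{1/2} g` in both factors gives a between-class term, two cross terms and a
  -- within-class term, each bounded by one of the concentration hypotheses.
  have key : ∑ i, inner ℝ e (sampleOf μ S y g i).1 * inner ℝ b (sampleOf μ S y g i).1 -
      n * popForm prior μ S e b =
      (∑ i, inner ℝ e (μ (y i)) * inner ℝ b (μ (y i)) -
        n * ∑ ℓ, prior ℓ * (inner ℝ e (μ ℓ) * inner ℝ b (μ ℓ))) +
      ∑ i, inner ℝ (sqrtOp S e) (g i) * inner ℝ b (μ (y i)) +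
      ∑ i, inner ℝ (sqrtOp S b) (g i) * inner ℝ e (μ (y i)) +
      (∑ i, inner ℝ (sqrtOp S e) (g i) * inner ℝ (sqrtOp S b) (g i) -
        n * inner ℝ (sqrtOp S e) (sqrtOp S b)) := by
    have : ∑ i, inner ℝ e (sampleOf μ S y g i).1 * inner ℝ b (sampleOf μ S y g i).1 =
        ∑ i, inner ℝ e (μ (y i)) * inner ℝ b (μ (y i)) +
        ∑ i, inner ℝ (sqrtOp S e) (g i) * inner ℝ b (μ (y i)) +
        ∑ i, inner ℝ (sqrtOp S b) (g i) * inner ℝ e (μ (y i)) +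
        ∑ i, inner ℝ (sqrtOp S e) (g i) * inner ℝ (sqrtOp S b) (g i) := by
      simp only [← Finset.sum_add_distrib, inner_sampleOf]
      exact Finset.sum_congr rfl fun i _ => by ring
    rw [this, popForm]
    ring
  rw [key]
  rw [mul_assoc (n * t : ℝ)] at h4
  refine ((abs_add_le _ _).trans (add_le_add (abs_add_three _ _ _) le_rfl)).trans ?_
  linarith

/-- The sample built from labels and Gaussian vectors is good on the three concentration events. -/
lemma sampleOf_mem_goodSamples (hn : 1 ≤ n) (hprior : ∀ ℓ, 0 < prior ℓ) {m : ℝ}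
    (hm : ∀ ℓ, prior ℓ ≤ m) (ht : 0 ≤ t) (ht8 : 8 * t ≤ 1)
    (hy : ∀ ℓ, |∑ i, (if y i = ℓ then (1 : ℝ) else 0) - n * prior ℓ| ≤ t * (n * prior ℓ))
    (hcov : ∀ h h' : EuclideanSpace ℝ (Fin p),
      |∑ i, inner ℝ h (g i) * inner ℝ h' (g i) - n * inner ℝ h h'| ≤ n * t * ‖h‖ * ‖h'‖)
    (hg : ∀ (h : EuclideanSpace ℝ (Fin p)) (w : EuclideanSpace ℝ (Fin L)),
      |∑ i, inner ℝ h (g i) * labelWeight prior y w i| ≤ n * t * ‖h‖ * ‖w‖)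
    {B : Matrix (Fin p) (Fin L) ℝ}
    (hB : ∀ (e : EuclideanSpace ℝ (Fin p)) (v : Fin L → ℝ),
      popForm prior μ S e (WithLp.toLp 2 (B.mulVec v)) =
        ∑ ℓ, prior ℓ * (inner ℝ e (μ ℓ) * v ℓ)) :
    sampleOf μ S y g ∈ goodSamples n prior μ S B (72 * t ^ 2 * m) := by
  have hn' : (0 : ℝ) < n := by exact_mod_cast hn
  have hgram := abs_gram_sub_le (μ := μ) (S := S) hprior ht hy hcov hg
  have hnn : ∀ x : EuclideanSpace ℝ (Fin p), 0 ≤ ∑ ℓ, prior ℓ * inner ℝ x (μ ℓ) ^ 2 := fun x =>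
    Finset.sum_nonneg fun ℓ _ => mul_nonneg (hprior ℓ).le (sq_nonneg _)
  have hpop : ∀ x, 0 ≤ popForm prior μ S x x := fun x => by
    rw [popForm_self]; exact add_nonneg (hnn x) (sq_nonneg _)
  intro e
  have hlow : n * popForm prior μ S e e ≤ 2 * ∑ i, inner ℝ e (sampleOf μ S y g i).1 ^ 2 := by
    have h1 := (abs_le.1 (hgram e e)).1
    rw [Real.mul_self_sqrt (hpop e)] at h1
    simp only [← sq] at h1
    nlinarith [mul_nonneg hn'.le (hpop e)]
  refine ⟨hlow, fun v => ?_⟩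
  set b : EuclideanSpace ℝ (Fin p) := WithLp.toLp 2 (B.mulVec v) with hb
  set Q := √(popForm prior μ S e e)
  set V := √(∑ ℓ, prior ℓ * v ℓ ^ 2)
  have hQ0 : 0 ≤ Q := Real.sqrt_nonneg _
  have hV0 : 0 ≤ V := Real.sqrt_nonneg _
  have hQs : Q ^ 2 = popForm prior μ S e e := Real.sq_sqrt (hpop e)
  have hVs : V ^ 2 = ∑ ℓ, prior ℓ * v ℓ ^ 2 := Real.sq_sqrt
    (Finset.sum_nonneg fun ℓ _ => mul_nonneg (hprior ℓ).le (sq_nonneg _))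
  have hbetween : √(∑ ℓ, prior ℓ * inner ℝ e (μ ℓ) ^ 2) ≤ Q := by
    refine Real.sqrt_le_sqrt ?_
    rw [popForm_self]
    exact le_add_of_nonneg_right (sq_nonneg _)
  have hwithin : ‖sqrtOp S e‖ ≤ Q := by
    refine Real.le_sqrt_of_sq_le ?_
    rw [popForm_self]
    exact le_add_of_nonneg_left (hnn e)
  -- The population regression is a projection, hence a contraction: by the normal equations and
  -- Cauchy–Schwarz, the squared norm of `b` is at most the norm of `b` times `V`.
  have hbV : √(popForm prior μ S b b) ≤ V := by
    have hcs := Finset.sum_mul_sq_le_sq_mul_sq Finset.univ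
      (fun ℓ => √(prior ℓ) * inner ℝ b (μ ℓ)) (fun ℓ => √(prior ℓ) * v ℓ)
    simp only [mul_pow, Real.sq_sqrt (hprior _).le] at hcs
    have e1 : ∑ ℓ, √(prior ℓ) * inner ℝ b (μ ℓ) * (√(prior ℓ) * v ℓ) =
        popForm prior μ S b b := by
      rw [hB b v]
      refine Finset.sum_congr rfl fun ℓ _ => ?_
      have := Real.mul_self_sqrt (hprior ℓ).le
      linear_combination (inner ℝ b (μ ℓ) * v ℓ) * this
    have e2 : ∑ ℓ, prior ℓ * inner ℝ b (μ ℓ) ^ 2 ≤ popForm prior μ S b b := by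
      rw [popForm_self]; exact le_add_of_nonneg_right (sq_nonneg _)
    rw [e1, ← hVs] at hcs
    have h3 : popForm prior μ S b b ^ 2 ≤ popForm prior μ S b b * V ^ 2 :=
      hcs.trans (by gcongr)
    rw [Real.sqrt_le_left hV0]
    rcases (hpop b).eq_or_lt with h0 | h0
    · rw [← h0]; positivity
    · nlinarith
  -- The normal equations let equal population terms be subtracted, so that only deviations are
  -- left, with constants 1, 1 and 4.
  have hres : ∑ i, inner ℝ e (sampleOf μ S y g i).1 * residual B v (sampleOf μ S y g i) =
      (∑ i, inner ℝ e (μ (y i)) * v (y i) - n * ∑ ℓ, prior ℓ * (inner ℝ e (μ ℓ) * v ℓ)) +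
      ∑ i, inner ℝ (sqrtOp S e) (g i) * v (y i) -
      (∑ i, inner ℝ e (sampleOf μ S y g i).1 * inner ℝ b (sampleOf μ S y g i).1 -
        n * popForm prior μ S e b) := by
    have : ∑ i, inner ℝ e (sampleOf μ S y g i).1 * residual B v (sampleOf μ S y g i) =
        ∑ i, inner ℝ e (μ (y i)) * v (y i) + ∑ i, inner ℝ (sqrtOp S e) (g i) * v (y i) -
        ∑ i, inner ℝ e (sampleOf μ S y g i).1 * inner ℝ b (sampleOf μ S y g i).1 := by
      simp only [← Finset.sum_add_distrib, ← Finset.sum_sub_distrib]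
      refine Finset.sum_congr rfl fun i _ => ?_
      rw [residual, ← hb, mul_sub]
      nth_rewrite 1 [inner_sampleOf]
      rw [add_mul]
      rfl
    rw [this, hB e v]
    ring
  have hnt : 0 ≤ n * t := by positivity
  have h1 := abs_sum_label_sub_le hprior ht hy (fun ℓ => inner ℝ e (μ ℓ)) v
  have h2 := abs_sum_inner_label_le hprior hg (sqrtOp S e) v
  have k1 := mul_le_mul_of_nonneg_left (mul_le_mul_of_nonneg_right hbetween hV0) hnt
  have k2 := mul_le_mul_of_nonneg_left (mul_le_mul_of_nonneg_right hwithin hV0) hnt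
  have k3 := mul_le_mul_of_nonneg_left (mul_le_mul_of_nonneg_left hbV hQ0) hnt
  have habs : |∑ i, inner ℝ e (sampleOf μ S y g i).1 * residual B v (sampleOf μ S y g i)| ≤
      6 * (n * t * (Q * V)) := by
    rw [hres]
    refine ((abs_sub _ _).trans (add_le_add (abs_add_le _ _) (hgram e b))).trans ?_
    linarith
  have hVm : V ^ 2 ≤ m * ∑ ℓ, v ℓ ^ 2 := by
    rw [hVs, Finset.mul_sum]
    exact Finset.sum_le_sum fun ℓ _ => mul_le_mul_of_nonneg_right (hm ℓ) (sq_nonneg _)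
  have hsq := sq_le_sq' (by linarith [(abs_le.1 habs).1]) (abs_le.1 habs).2
  -- The 72 is `6²` times the 2 of Gram domination, which replaces `n Q²` by the empirical sum; `m`
  -- comes from bounding the weights in `V²`.
  calc _ ≤ (6 * (n * t * (Q * V))) ^ 2 := hsq
    _ = 36 * n * t ^ 2 * V ^ 2 * (n * Q ^ 2) := by ring
    _ ≤ 36 * n * t ^ 2 * V ^ 2 * (2 * ∑ i, inner ℝ e (sampleOf μ S y g i).1 ^ 2) := by
      rw [hQs]; gcongr
    _ ≤ 36 * n * t ^ 2 * (m * ∑ ℓ, v ℓ ^ 2) *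
        (2 * ∑ i, inner ℝ e (sampleOf μ S y g i).1 ^ 2) := by
      have : 0 ≤ ∑ i, inner ℝ e (sampleOf μ S y g i).1 ^ 2 :=
        Finset.sum_nonneg fun _ _ => sq_nonneg _
      gcongr
    _ = _ := by ring

end Realization

end

/-! ### Probability of a good sample -/

section Probability

variable {n p L : ℕ} {ν : Measure (Obs p L)} {prior : Fin L → ℝ}
  {μ : Fin L → EuclideanSpace ℝ (Fin p)} {S : Matrix (Fin p) (Fin p) ℝ}

lemma measurable_sampleOf : Measurable
    fun a : (Fin n → Fin L) × (Fin n → EuclideanSpace ℝ (Fin p)) => sampleOf μ S a.1 a.2 := by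
  have : Measurable μ := measurable_of_countable μ
  unfold sampleOf
  fun_prop

/-- An i.i.d. sample is built from independent labels and standard Gaussian vectors. -/
lemma IsLDALaw.pi_eq_map (h : IsLDALaw ν prior μ S) :
    (Measure.pi fun _ : Fin n => ν) =
      ((Measure.pi fun _ : Fin n => ν.map Prod.snd).prod
        (Measure.pi fun _ : Fin n => stdGaussian (EuclideanSpace ℝ (Fin p)))).map
        fun a => sampleOf μ S a.1 a.2 := by
  have := h.isProbabilityMeasure
  have : IsProbabilityMeasure (ν.map Prod.snd) :=
    Measure.isProbabilityMeasure_map measurable_snd.aemeasurable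
  have hf : Measurable fun a : Fin L × EuclideanSpace ℝ (Fin p) =>
      ((μ a.1 + sqrtOp S a.2, a.1) : Obs p L) := by
    have : Measurable μ := measurable_of_countable μ
    fun_prop
  have : IsProbabilityMeasure
      (((ν.map Prod.snd).prod (stdGaussian (EuclideanSpace ℝ (Fin p)))).map
        fun a => ((μ a.1 + sqrtOp S a.2, a.1) : Obs p L)) :=
    Measure.isProbabilityMeasure_map hf.aemeasurable
  conv_lhs => rw [h.eq_map]
  rw [← Measure.pi_map_pi fun _ => hf.aemeasurable,
    ← (measurePreserving_arrowProdEquivProdArrow (Fin L) (EuclideanSpace ℝ (Fin p)) (Fin n)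
      (fun _ => ν.map Prod.snd) (fun _ => stdGaussian (EuclideanSpace ℝ (Fin p)))).map_eq,
    Measure.map_map measurable_sampleOf (MeasurableEquiv.measurable _)]
  rfl

/-- The probability that a sample is not good. -/
lemma IsLDALaw.pi_compl_goodSamples_le (h : IsLDALaw ν prior μ S) (hn : 1 ≤ n) {m m' : ℝ}
    (hm : ∀ ℓ, m ≤ prior ℓ) (hm' : ∀ ℓ, prior ℓ ≤ m') {t : ℝ} (ht : 0 ≤ t) (ht8 : 8 * t ≤ 1) :
    (Measure.pi fun _ : Fin n => ν) (goodSamples n prior μ S (regMatrix ν) (72 * t ^ 2 * m'))ᶜ ≤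
      ENNReal.ofReal (L * (2 * Real.exp (-(n * m * t ^ 2 / 4))) +
        ((25 ^ p * 25 ^ p) * (4 * Real.exp (-(n * t ^ 2 / 16384))) +
          (25 ^ p * 25 ^ L) * (2 * Real.exp (-(n * t ^ 2 / 1024))))) := by
  have := h.isProbabilityMeasure
  have : IsProbabilityMeasure (ν.map Prod.snd) :=
    Measure.isProbabilityMeasure_map measurable_snd.aemeasurable
  have hκ : ∀ ℓ, (ν.map Prod.snd).real {ℓ} = prior ℓ := fun ℓ => by
    rw [map_measureReal_apply measurable_snd (measurableSet_singleton ℓ), h.prob_label]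
  have hG := (measurableSet_goodSamples (n := n) prior μ S (regMatrix ν) (72 * t ^ 2 * m')).compl
  set G := goodSamples n prior μ S (regMatrix ν) (72 * t ^ 2 * m')
  set κ := Measure.pi fun _ : Fin n => ν.map Prod.snd
  set γ := Measure.pi fun _ : Fin n => stdGaussian (EuclideanSpace ℝ (Fin p))
  set ε : ℝ := (25 ^ p * 25 ^ p) * (4 * Real.exp (-(n * t ^ 2 / 16384))) +
    (25 ^ p * 25 ^ L) * (2 * Real.exp (-(n * t ^ 2 / 1024)))
  let bad : Set (Fin n → Fin L) := {y | ¬ ∀ ℓ,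
    |∑ i, (if y i = ℓ then (1 : ℝ) else 0) - n * prior ℓ| ≤ t * (n * prior ℓ)}
  have hbad : κ bad ≤ ENNReal.ofReal (L * (2 * Real.exp (-(n * m * t ^ 2 / 4)))) := by
    have := pi_count_tail (n := n) (ν.map Prod.snd) (m := m) (fun ℓ => by rw [hκ]; exact hm ℓ)
      ht (by linarith)
    simp only [hκ] at this
    rw [← ofReal_measureReal (μ := κ) (s := bad)]
    exact ENNReal.ofReal_le_ofReal this
  -- Condition on the labels: for fixed good `y` the weights are deterministic and bounded, so the
  -- Gaussian bounds apply; integrating over `y` adds only the mass of `bad`.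
  have hcond : ∀ y ∉ bad, γ ((fun g => sampleOf μ S y g) ⁻¹' Gᶜ) ≤ ENNReal.ofReal ε := by
    intro y hy
    simp only [bad, Set.mem_ofPred_eq, not_not] at hy
    have h1 := stdGaussian_pi_covariance_tail (E := EuclideanSpace ℝ (Fin p)) (n := n) ht
      (by linarith : t ≤ 1)
    have h2 := stdGaussian_pi_bilinear_tail (E := EuclideanSpace ℝ (Fin p)) (labelWeight prior y)
      (sum_labelWeight_sq_le h.prior_pos (by linarith : t ≤ 1) hy) ht
    rw [finrank_euclideanSpace_fin] at h1
    rw [finrank_euclideanSpace_fin, finrank_euclideanSpace_fin] at h2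
    rw [← ofReal_measureReal (μ := γ)]
    refine ENNReal.ofReal_le_ofReal (le_trans ?_ (add_le_add h1 h2))
    refine le_trans (measureReal_mono ?_ (measure_ne_top _ _)) (measureReal_union_le _ _)
    intro g hg
    by_contra hcon
    simp only [Set.mem_union, Set.mem_ofPred_eq, not_or, not_not] at hcon
    exact hg (sampleOf_mem_goodSamples hn h.prior_pos hm' ht ht8 hy hcon.1 hcon.2
      h.popForm_regMatrix)
  rw [h.pi_eq_map, Measure.map_apply measurable_sampleOf hG,
    Measure.prod_apply (measurable_sampleOf hG)]
  have hbadm : MeasurableSet bad := (Set.toFinite bad).measurableSet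
  calc _ ≤ ∫⁻ y, bad.indicator 1 y + ENNReal.ofReal ε ∂κ := by
        refine lintegral_mono fun y => ?_
        by_cases hy : y ∈ bad
        · rw [Set.indicator_of_mem hy]
          exact prob_le_one.trans le_self_add
        · rw [Set.indicator_of_notMem hy, zero_add]
          exact hcond y hy
    _ = κ bad + ENNReal.ofReal ε := by
        rw [lintegral_add_right _ measurable_const, lintegral_indicator_one hbadm,
          lintegral_const, measure_univ, mul_one]
    _ ≤ _ := by
        have hε : 0 ≤ ε := by positivity
        rw [ENNReal.ofReal_add (q := ε) (by positivity) hε]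
        exact add_le_add hbad le_rfl

end Probability

/-! ### Choice of constants and assembly -/

lemma one_le_log_of_three_le {n : ℕ} (hn : 3 ≤ n) : 1 ≤ Real.log n := by
  have hn' : (3 : ℝ) ≤ n := by exact_mod_cast hn
  rw [Real.le_log_iff_exp_le (by linarith)]
  linarith [Real.exp_one_lt_d9]

/-- The failure probability at deviation level `K √((p + L) log n / n)`. -/
lemma failure_probability_le {n p L : ℕ} (hn : 3 ≤ n) (hL : 2 ≤ L) {cπ K t : ℝ} (hcπ : 0 < cπ)
    (hK : 512 ≤ K) (hKc : 16 ≤ cπ * K ^ 2)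
    (ht : n * t ^ 2 = K ^ 2 * (((p : ℝ) + L) * Real.log n))
    (hsmall : ((p : ℝ) + L) * Real.log n ≤ n) :
    L * (2 * Real.exp (-(n * (cπ / L) * t ^ 2 / 4))) +
        ((25 ^ p * 25 ^ p) * (4 * Real.exp (-(n * t ^ 2 / 16384))) +
          (25 ^ p * 25 ^ L) * (2 * Real.exp (-(n * t ^ 2 / 1024)))) ≤ 2 / n := by
  have hlog := one_le_log_of_three_le hn
  have hn' : (3 : ℝ) ≤ n := by exact_mod_cast hn
  have hL' : (2 : ℝ) ≤ L := by exact_mod_cast hL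
  have hp' : (0 : ℝ) ≤ p := Nat.cast_nonneg p
  set ℓ := Real.log n
  set x := ((p : ℝ) + L) * ℓ with hx
  have hLx : L ≤ x := by nlinarith
  have hpx : p ≤ x := by nlinarith
  have hℓx : ℓ ≤ x := by nlinarith
  have hx0 : 0 ≤ x := by linarith
  have hexp : ∀ k : ℕ, Real.exp (-(k * ℓ)) = ((n : ℝ)⁻¹) ^ k := by
    intro k
    rw [Real.exp_neg, Real.exp_nat_mul, Real.exp_log (by linarith), inv_pow]
  have h25 : (25 : ℝ) ≤ Real.exp 4 := by
    have : Real.exp 4 = Real.exp 1 ^ 4 := by rw [← Real.exp_nat_mul]; norm_num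
    rw [this]
    calc (25 : ℝ) ≤ 2.7 ^ 4 := by norm_num
      _ ≤ _ := by
        gcongr
        linarith [Real.exp_one_gt_d9]
  have hpow : ∀ k : ℕ, (k : ℝ) ≤ x → (25 : ℝ) ^ k ≤ Real.exp (4 * x) := by
    intro k hk
    calc (25 : ℝ) ^ k ≤ Real.exp 4 ^ k := by gcongr
      _ = Real.exp (k * 4) := by rw [Real.exp_nat_mul]
      _ ≤ _ := Real.exp_le_exp.2 (by linarith)
  have hK2 : 262144 ≤ K ^ 2 := by nlinarith
  have hKx : 262144 * x ≤ K ^ 2 * x := by gcongr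
  have hn0 : (0 : ℝ) < (n : ℝ)⁻¹ := by positivity
  have hninv : (n : ℝ)⁻¹ * n = 1 := inv_mul_cancel₀ (by linarith)
  have hinv3 : (n : ℝ)⁻¹ ≤ 1 / 3 := by
    rw [one_div]; exact inv_anti₀ (by norm_num) hn'
  -- Since `x / L ≥ log n` and `cπ K² ≥ 16`, each class fails with probability at most `2 n⁻⁴`; the
  -- union is over `L ≤ n` classes.
  have h1 : L * (2 * Real.exp (-(n * (cπ / L) * t ^ 2 / 4))) ≤ (n : ℝ)⁻¹ := by
    have e : 4 * ℓ ≤ n * (cπ / L) * t ^ 2 / 4 := by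
      have e1 : n * (cπ / L) * t ^ 2 / 4 = cπ * K ^ 2 * (x / L) / 4 := by
        have : n * (cπ / L) * t ^ 2 / 4 = (cπ / L) * (n * t ^ 2) / 4 := by ring
        rw [this, ht]; ring
      have e2 : ℓ ≤ x / L := by
        rw [le_div_iff₀ (by linarith), hx]; nlinarith
      rw [e1]
      have : 16 * ℓ ≤ cπ * K ^ 2 * (x / L) := by gcongr
      linarith
    have e3 : Real.exp (-(n * (cπ / L) * t ^ 2 / 4)) ≤ ((n : ℝ)⁻¹) ^ 4 := by
      rw [← hexp 4]
      exact Real.exp_le_exp.2 (by push_cast; linarith)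
    have hLn : (L : ℝ) ≤ n := hLx.trans hsmall
    calc _ ≤ n * (2 * ((n : ℝ)⁻¹) ^ 4) := by gcongr
      _ = 2 * ((n : ℝ)⁻¹ * n) * ((n : ℝ)⁻¹ * (n : ℝ)⁻¹) * (n : ℝ)⁻¹ := by ring
      _ ≤ 2 * ((n : ℝ)⁻¹ * n) * (1 / 3 * (1 / 3)) * (n : ℝ)⁻¹ := by gcongr
      _ ≤ _ := by rw [hninv]; linarith
  have hcube : ((n : ℝ)⁻¹) ^ 3 ≤ (n : ℝ)⁻¹ / 9 := by
    calc _ = (n : ℝ)⁻¹ * (n : ℝ)⁻¹ * (n : ℝ)⁻¹ := by ring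
      _ ≤ 1 / 3 * (1 / 3) * (n : ℝ)⁻¹ := by gcongr
      _ = _ := by ring
  -- Two nets cost `exp(8x)`. As `512² / 16384 = 16`, the tails gain at least `exp(-16x)`, and `8x ≥
  -- 3 log n`.
  have hgauss : ∀ y : ℝ, 16 * x ≤ y →
      Real.exp (4 * x) * Real.exp (4 * x) * Real.exp (-y) ≤ ((n : ℝ)⁻¹) ^ 3 := by
    intro y hy
    rw [← hexp 3, ← Real.exp_add, ← Real.exp_add]
    exact Real.exp_le_exp.2 (by push_cast; linarith)
  have h2 : (25 ^ p * 25 ^ p) * (4 * Real.exp (-(n * t ^ 2 / 16384))) ≤ 4 * ((n : ℝ)⁻¹) ^ 3 := by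
    calc _ ≤ (Real.exp (4 * x) * Real.exp (4 * x)) *
          (4 * Real.exp (-(n * t ^ 2 / 16384))) := by
          gcongr
          exacts [hpow p hpx, hpow p hpx]
      _ = 4 * (Real.exp (4 * x) * Real.exp (4 * x) * Real.exp (-(n * t ^ 2 / 16384))) := by ring
      _ ≤ _ := by
          gcongr
          exact hgauss _ (by rw [ht]; linarith)
  have h3 : (25 ^ p * 25 ^ L) * (2 * Real.exp (-(n * t ^ 2 / 1024))) ≤ 2 * ((n : ℝ)⁻¹) ^ 3 := by
    calc _ ≤ (Real.exp (4 * x) * Real.exp (4 * x)) *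
          (2 * Real.exp (-(n * t ^ 2 / 1024))) := by
          gcongr
          exacts [hpow p hpx, hpow L hLx]
      _ = 2 * (Real.exp (4 * x) * Real.exp (4 * x) * Real.exp (-(n * t ^ 2 / 1024))) := by ring
      _ ≤ _ := by
          gcongr
          exact hgauss _ (by rw [ht]; linarith)
  have h4 : 2 / (n : ℝ) = 2 * (n : ℝ)⁻¹ := div_eq_mul_inv _ _
  linarith

/-- The degenerate case `p = 0`, where the lower bound on the operator norm is unavailable and there
is nothing to estimate. -/
lemma errorBounds_of_no_features {n L : ℕ} (d : Fin n → Obs 0 L)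
    (S : Matrix (Fin 0) (Fin 0) ℝ) (A B : Matrix (Fin 0) (Fin L) ℝ) {ω₁ ω₂ : ℝ} (h₁ : 0 ≤ ω₁)
    (h₂ : 0 ≤ ω₂) : ErrorBounds d S A B ω₁ ω₂ := by
  have h : A - B = 0 := Subsingleton.elim _ _
  simp [ErrorBounds, h, frobNorm, rowNorm, h₁, h₂]

/-- An almost sure event and the preimage of a set of law at least `1 - δ` contain a common
measurable event of probability at least `1 - δ`. -/
lemma exists_measurableSet_of_hasLaw {Ω 𝓧 : Type*} [MeasurableSpace Ω] [MeasurableSpace 𝓧]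
    {P : Measure Ω} [IsProbabilityMeasure P] {m : Measure 𝓧} {X : Ω → 𝓧} (hX : HasLaw X m P)
    {G : Set 𝓧} (hG : MeasurableSet G) {δ : ℝ} (hδ : 0 ≤ δ) (hm : m Gᶜ ≤ ENNReal.ofReal δ)
    {q : Ω → Prop} (hq : ∀ᵐ ω ∂P, q ω) :
    ∃ E : Set Ω, MeasurableSet E ∧ 1 - δ ≤ P.real E ∧ ∀ ω ∈ E, X ω ∈ G ∧ q ω := by
  let bad : Set Ω := X ⁻¹' Gᶜ ∪ {ω | ¬ q ω}
  have hbad : P bad ≤ ENNReal.ofReal δ := by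
    refine (measure_union_le _ _).trans ?_
    rw [ae_iff.1 hq, add_zero, ← Measure.map_apply_of_aemeasurable hX.aemeasurable hG.compl,
      hX.map_eq]
    exact hm
  -- The estimator need not be measurable, so the bad set is replaced by a measurable hull of the
  -- same probability.
  refine ⟨(toMeasurable P bad)ᶜ, (measurableSet_toMeasurable _ _).compl, ?_, fun ω hω => ?_⟩
  · rw [probReal_compl_eq_one_sub (measurableSet_toMeasurable _ _), measureReal_def,
      measure_toMeasurable]
    have := ENNReal.toReal_le_of_le_ofReal hδ hbad
    linarith
  · have h : ω ∉ bad := fun h => hω (subset_toMeasurable P bad h)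
    simp only [bad, Set.mem_union, Set.mem_preimage, Set.mem_compl_iff, Set.mem_ofPred_eq, not_or,
      not_not] at h
    exact h

/-- The probability bound and the error bounds, at deviation level `K √((p + L) log n / n)`. -/
lemma IsLDALaw.exists_event_errorBounds {n p L : ℕ} {ν : Measure (Obs p L)} {prior : Fin L → ℝ}
    {μ : Fin L → EuclideanSpace ℝ (Fin p)} {S : Matrix (Fin p) (Fin p) ℝ} {cπ Cπ cW K lam : ℝ}
    (hlaw : IsLDALaw ν prior μ S) (hn : 3 ≤ n) (hL : 2 ≤ L) (hcπ : 0 < cπ) (hCπ : 0 ≤ Cπ)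
    (hcW : 0 < cW) (hbal : BalancedPriors cπ Cπ prior)
    (hwithin : ∃ hS : S.IsHermitian, ∀ j, cW < hS.eigenvalues j)
    (hK : 512 ≤ K) (hKc : 16 ≤ cπ * K ^ 2)
    (hsize : 64 * K ^ 2 * (((p : ℝ) + L) * Real.log n) ≤ n)
    (hlam : 144 * K ^ 2 * Cπ * (((p : ℝ) + L) * Real.log n / (n * L)) ≤ lam)
    {Ω : Type*} [MeasurableSpace Ω] {P : Measure Ω} [IsProbabilityMeasure P]
    {D : Fin n → Ω → Obs p L} (hind : iIndepFun D P) (hD : ∀ i, HasLaw (D i) ν P)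
    {Bhat : Ω → Matrix (Fin p) (Fin L) ℝ}
    (hB : ∀ᵐ ω ∂P, IsRankEstimate lam (fun i => D i ω) (Bhat ω)) :
    ∃ E : Set Ω, MeasurableSet E ∧ 1 - 2 / (n : ℝ) ≤ P.real E ∧
      ∀ ω ∈ E, ErrorBounds (fun i => D i ω) S (Bhat ω) (regMatrix ν)
        (3 / √cW * √(lam * (regMatrix ν).rank * p)) (3 * √(lam * (regMatrix ν).rank)) := by
  have hn0 : (0 : ℝ) < n := by
    have : (3 : ℝ) ≤ n := by exact_mod_cast hn
    linarith
  have hx0 : 0 ≤ ((p : ℝ) + L) * Real.log n := by positivity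
  generalize hx : ((p : ℝ) + L) * Real.log n = x at *
  obtain ⟨t, ht0, htsq⟩ : ∃ t : ℝ, 0 ≤ t ∧ t ^ 2 = K ^ 2 * (x / n) :=
    ⟨√(K ^ 2 * (x / n)), Real.sqrt_nonneg _, Real.sq_sqrt (by positivity)⟩
  have hnt : n * t ^ 2 = K ^ 2 * x := by rw [htsq]; field_simp
  have ht8 : 8 * t ≤ 1 := by
    have h1 : K ^ 2 * (x / n) ≤ 1 / 64 := by
      rw [← mul_div_assoc, div_le_iff₀ hn0]
      linarith
    nlinarith
  have hsmall : x ≤ n := by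
    have h1 : 1 ≤ 64 * K ^ 2 := by nlinarith
    nlinarith
  have hδ := failure_probability_le hn hL hcπ hK hKc (by rw [hx]; exact hnt)
    (by rw [hx]; exact hsmall)
  have hprob := hlaw.pi_compl_goodSamples_le (by omega : 1 ≤ n) (fun ℓ => (hbal ℓ).1)
    (fun ℓ => (hbal ℓ).2) ht0 ht8
  obtain ⟨E, hE, hPE, hEgood⟩ := exists_measurableSet_of_hasLaw
    (hind.hasLaw_pi hD) (measurableSet_goodSamples prior μ S _ _) (by positivity)
    (hprob.trans (ENNReal.ofReal_le_ofReal hδ)) hB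
  refine ⟨E, hE, hPE, fun ω hω => ?_⟩
  refine errorBounds_of_mem_goodSamples (by omega) (fun ℓ => (hlaw.prior_pos ℓ).le)
    hlaw.posDef.posSemidef hcW hwithin (hEgood ω hω).1 (by positivity) ?_ (hEgood ω hω).2
  -- Here `H = 72 t² Cπ / L`, and `2H` is exactly the level assumed for `lam`.
  refine le_trans (le_of_eq ?_) hlam
  rw [htsq]
  ring

/-- The penalty level dominates the squared operator norm of the noise. -/
lemma noise_level_le {a b m k c : ℝ} (ha : 0 ≤ a) (ha1 : a ≤ 1) (hc : 0 < c) (hcm : c ≤ m)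
    (hb : 0 ≤ b) (hk : 0 ≤ k) : k * a ≤ k / √c * √(m * (1 + b)) * √a := by
  have h1 : √c ≤ √(m * (1 + b)) := Real.sqrt_le_sqrt (by nlinarith)
  have h2 : a ≤ √a := Real.le_sqrt_of_sq_le (by nlinarith)
  have h3 : √c ≠ 0 := (Real.sqrt_pos.2 hc).ne'
  calc k * a ≤ k * √a := by gcongr
    _ = k / √c * √c * √a := by rw [div_mul_cancel₀ _ h3]
    _ ≤ _ := by gcongr

end LDARegression

theorem theorem8 (cπ Cπ cΔ CΔ cW CW : ℝ) (hcπ : 0 < cπ) (hcΔ : 0 < cΔ) (hcW : 0 < cW) :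
    ∃ c > 0, ∃ C > 0, ∃ K₁ > 0, ∃ K₂ > 0,
      ∀ (n p L : ℕ), 1 ≤ n → 2 ≤ L →
      ∀ (ν : Measure (LDARegression.Obs p L)) (prior : Fin L → ℝ)
        (μ : Fin L → EuclideanSpace ℝ (Fin p)) (S : Matrix (Fin p) (Fin p) ℝ) (Δ : ℝ),
        LDARegression.IsLDALaw ν prior μ S →
        LDARegression.BalancedPriors cπ Cπ prior →
        0 < Δ → LDARegression.SeparatedMeans cΔ CΔ Δ μ S →
        LDARegression.BoundedWithinCov cW CW S →
        ((p : ℝ) + L) * Real.log n ≤ c * n →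
      ∀ lam : ℝ, 0 < lam →
        C * √(LDARegression.opNorm S * (1 + Δ)) *
          √(((p : ℝ) + L) * Real.log n / ((n : ℝ) * L)) ≤ lam →
      ∀ (Ω : Type*) [MeasurableSpace Ω] (P : Measure Ω) [IsProbabilityMeasure P]
        (D : Fin n → Ω → LDARegression.Obs p L),
        iIndepFun D P → (∀ i, HasLaw (D i) ν P) →
      ∀ Bhat : Ω → Matrix (Fin p) (Fin L) ℝ,
        (∀ᵐ ω ∂P, LDARegression.IsRankEstimate lam (fun i => D i ω) (Bhat ω)) →
        ∃ E : Set Ω, MeasurableSet E ∧ 1 - 2 / (n : ℝ) ≤ P.real E ∧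
          ∀ ω ∈ E, LDARegression.ErrorBounds (fun i => D i ω) S (Bhat ω)
            (LDARegression.regMatrix ν)
            (K₁ * √(lam * ((LDARegression.regMatrix ν).rank : ℝ) * p))
            (K₂ * √(lam * ((LDARegression.regMatrix ν).rank : ℝ))) := by
  -- The 512 beats the cardinality of the nets; `4 / √cπ` secures the label-count bound.
  have hK : 512 ≤ 512 + 4 / √cπ := le_add_of_nonneg_right (by positivity)
  have hKc : 16 ≤ cπ * (512 + 4 / √cπ) ^ 2 := by
    calc 16 = cπ * (4 / √cπ) ^ 2 := by
          rw [div_pow, Real.sq_sqrt hcπ.le]; field_simp; norm_num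
      _ ≤ _ := by
          gcongr
          linarith
  generalize 512 + 4 / √cπ = K at hK hKc
  have hK0 : 0 < K := by linarith
  refine ⟨1 / (64 * K ^ 2), by positivity, 144 * K ^ 2 * (|Cπ| + 1) / √cW, by positivity,
    3 / √cW, by positivity, 3, by norm_num, ?_⟩
  intro n p L hn hL ν prior μ S Δ hlaw hbal hΔ _ hwithin hsize lam hlam0 hlam Ω _ P _ D hind hD
    Bhat hB
  rcases Nat.eq_zero_or_pos p with rfl | hp
  · refine ⟨Set.univ, MeasurableSet.univ, ?_, fun ω _ =>
      LDARegression.errorBounds_of_no_features _ _ _ _ (by positivity) (by positivity)⟩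
    rw [probReal_univ]
    linarith [show (0 : ℝ) ≤ 2 / n by positivity]
  have hn0 : (0 : ℝ) < n := by exact_mod_cast hn
  -- For `n ≤ 2` the required probability `1 - 2/n` is at most zero and the empty event suffices;
  -- afterwards `log n ≥ 1`.
  rcases Nat.lt_or_ge n 3 with hn3 | hn3
  · refine ⟨∅, MeasurableSet.empty, ?_, fun ω hω => hω.elim⟩
    have h1 : (n : ℝ) ≤ 2 := by exact_mod_cast Nat.lt_succ_iff.1 hn3
    have h3 : 1 ≤ 2 / (n : ℝ) := by rwa [le_div_iff₀ hn0, one_mul]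
    rw [measureReal_empty]
    linarith
  have hsize' : 64 * K ^ 2 * (((p : ℝ) + L) * Real.log n) ≤ n := by
    calc _ ≤ 64 * K ^ 2 * (1 / (64 * K ^ 2) * n) := by gcongr
      _ = n := by field_simp
  have hL0 : (2 : ℝ) ≤ L := by exact_mod_cast hL
  have hx0 : 0 ≤ ((p : ℝ) + L) * Real.log n := by positivity
  have hratio : ((p : ℝ) + L) * Real.log n / (n * L) ≤ 1 := by
    rw [div_le_one (by positivity)]
    have h1 : 1 ≤ 64 * K ^ 2 := by nlinarith
    calc _ ≤ 64 * K ^ 2 * (((p : ℝ) + L) * Real.log n) := le_mul_of_one_le_left hx0 h1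
      _ ≤ n := hsize'
      _ ≤ n * L := le_mul_of_one_le_right hn0.le (by linarith)
  refine hlaw.exists_event_errorBounds hn3 hL hcπ (by positivity : 0 ≤ |Cπ| + 1) hcW
    (fun ℓ => ⟨(hbal ℓ).1, (hbal ℓ).2.trans ?_⟩) hwithin.1 hK hKc hsize' ?_ hind hD hB
  · gcongr
    linarith [le_abs_self Cπ]
  · exact (LDARegression.noise_level_le (by positivity) hratio hcW
      (LDARegression.le_opNorm_of_lt_eigenvalues hp hlaw.posDef.posSemidef hwithin.1) hΔ.le
      (by positivity)).trans hlam
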